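/- Fix a universe $\mathcal U$; "small" means $\mathcal U$-small. Let $\theta: R\to S$ be a surjective homomorphism of small coherent commutative rings such that $S$ is finitely presented as an $R$-module and the ideal $I=\ker\theta$ is nilpotent ($I^n=0$ for some $n$). Let $\mathcal D$ be an $S$-linear abelian category and $\mathcal C$ an $R$-linear abelian category, both with small Hom-sets, and let $F:\mathcal D\to\mathcal C$ be a flat $R$-deformation of $\mathcal D$, that is: (a) $F$ is $R$-linear (where $R$ acts on $\mathcal D$ through $\theta$), and the induced functor $\mathcal D\to\mathcal C_S$, $A\mapsto (F(A),\ s\mapsto F(s\cdot 1_A))$, is an equivalence. Here $\mathcal C_S$ is the category of pairs $(C,\varphi)$ with $C$ an object of $\mathcal C$ and $\varphi:S\to\mathcal C(C,C)$ an $R$-algebra homomorphism, whose morphisms are the morphisms of $\mathcal C$ compatible with the actions of $S$. (b) $\mathcal C$ is flat over $R$ as an abelian category: for every finitely presented $R$-module $X$ the bifunctor $\operatorname{Ext}^1_R(X,\mathcal C(-,-)):\mathcal C^{\mathrm{op}}\times\mathcal C\to\mathsf{Ab}$ is weakly effaceable, i.e. for all objects $A,B$ of $\mathcal C$ and every $x\in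 \operatorname{Ext}^1_R(X,\mathcal C(A,B))$ there are an epimorphism $A'\to A$ and a monomorphism $B\to B'$ such that $x$ is mapped to $0$ in $\operatorname{Ext}^1_R(X,\mathcal C(A',B'))$. If $\mathcal D$ is a Grothendieck category (an abelian category with small Hom-sets in which all small colimits exist, small filtered colimits are exact, and which has a generator), then $\mathcal C$ is a Grothendieck category. -/

import Mathlib

open CategoryTheory CategoryTheory.Limits

universe w v u v' u'

/-- A commutative ring is coherent if all its finitely generated ideals are finitely presented. -/
class IsCoherentCommRing (R : Type u) [CommRing R] : Prop where
  finitePresentation_of_fg : ∀ I : Ideal R, I.FG → Module.FinitePresentation R I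

section Flatness

/-- A functor `F` with values in abelian groups is weakly effaceable if each element `x` of each
`F A` is killed by `F u` for some monomorphism `u : A ⟶ A'` (depending on `x`). -/
def WeaklyEffaceable {A : Type u} [Category.{v} A] (F : A ⥤ AddCommGrpCat.{w}) : Prop :=
  ∀ (a : A) (x : F.obj a), ∃ (a' : A) (i : a ⟶ a'), Mono i ∧ F.map i x = 0

variable (R : Type w) [CommRing R] (C : Type u) [Category.{w} C] [Abelian C] [Linear R C]

/-- The functor `(A, B) ↦ Extⁿ_R(X, C(A, B))` on `Cᵒᵖ × C`, where the Hom-group `C(A, B)` is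
regarded as an `R`-module. -/
noncomputable def extHomFunctor (X : ModuleCat.{w} R) (n : ℕ) : Cᵒᵖ × C ⥤ AddCommGrpCat.{w} :=
  Functor.uncurry.obj (linearCoyoneda R C) ⋙ Abelian.extFunctorObj X n

/-- Flatness over `R` of an `R`-linear abelian category (this is not flatness of its
Hom-modules): the bifunctor `Ext¹_R(X, C(-,-))` is weakly effaceable for every finitely presented
`R`-module `X`. A monomorphism of `Cᵒᵖ × C` is a pair consisting of an epimorphism `A' ⟶ A` and a
monomorphism `B ⟶ B'` of `C`. -/
def IsFlatAbelian : Prop :=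
  ∀ X : ModuleCat.{w} R, Module.FinitePresentation R X → WeaklyEffaceable (extHomFunctor R C X 1)

end Flatness

section BaseChange

variable (R : Type w) [CommRing R] (S : Type w) [CommRing S] [Algebra R S]
  (C : Type u) [Category.{v} C] [Preadditive C] [Linear R C]

/-- An `S`-object of an `R`-linear category `C`: an object of `C` together with an action of `S`
that extends the action of `R`. -/
structure SObject where
  obj : C
  act : S →ₐ[R] End obj

namespace SObject

variable {R S C}

/-- A morphism of `S`-objects is a morphism of `C` that commutes with the actions of `S`. -/
@[ext]
structure Hom (X Y : SObject R S C) where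
  hom : X.obj ⟶ Y.obj
  comm : ∀ s : S, (show X.obj ⟶ X.obj from X.act s) ≫ hom =
    hom ≫ (show Y.obj ⟶ Y.obj from Y.act s)

/-- The category `C_S` of `S`-objects of `C`. -/
instance : Category (SObject R S C) where
  Hom := Hom
  id X := ⟨𝟙 X.obj, fun s => by simp⟩
  comp f g := ⟨f.hom ≫ g.hom, fun s => by
    rw [← Category.assoc, f.comm, Category.assoc, g.comm, Category.assoc]⟩

end SObject

end BaseChange

section Deformation

variable (R : Type w) [CommRing R] (S : Type w) [CommRing S] [Algebra R S]
  {D : Type u'} [Category.{v'} D] [Preadditive D] [Linear S D]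
  {C : Type u} [Category.{v} C] [Preadditive C] [Linear R C]

/-- `F : D ⥤ C` is `R`-linear, where `R` acts on the `S`-linear category `D` by restriction of
scalars along `R → S`. -/
structure IsLinearOver (F : D ⥤ C) : Prop where
  map_add : ∀ {A B : D} (f g : A ⟶ B), F.map (f + g) = F.map f + F.map g
  map_smul : ∀ {A B : D} (r : R) (f : A ⟶ B), F.map (algebraMap R S r • f) = r • F.map f

variable {R S}

/-- The action of `S` on `F A`: the element `s` acts by `F (s • 𝟙 A)`. -/
def IsLinearOver.act {F : D ⥤ C} (hF : IsLinearOver R S F) (A : D) : S →ₐ[R] End (F.obj A) where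
  toFun s := F.map (s • 𝟙 A)
  map_one' := by rw [one_smul, F.map_id]; rfl
  map_mul' s t := by
    change F.map ((s * t) • 𝟙 A) = F.map (t • 𝟙 A) ≫ F.map (s • 𝟙 A)
    rw [← F.map_comp, Linear.comp_smul, Linear.smul_comp, Category.comp_id, smul_smul]
  map_zero' := by
    have h := hF.map_add (0 : A ⟶ A) 0
    rw [add_zero] at h
    rw [zero_smul]
    exact left_eq_add.mp h
  map_add' s t := by rw [add_smul]; exact hF.map_add _ _
  commutes' r := by
    change F.map (algebraMap R S r • 𝟙 A) = r • 𝟙 (F.obj A)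
    rw [hF.map_smul, F.map_id]

/-- The functor `D ⥤ C_S` induced by an `R`-linear functor `F : D ⥤ C`. -/
def IsLinearOver.toSObject {F : D ⥤ C} (hF : IsLinearOver R S F) : D ⥤ SObject R S C where
  obj A := ⟨F.obj A, hF.act A⟩
  map f := ⟨F.map f, fun s => by
    change F.map (s • 𝟙 _) ≫ F.map f = F.map f ≫ F.map (s • 𝟙 _)
    rw [← F.map_comp, ← F.map_comp, Linear.smul_comp, Linear.comp_smul, Category.id_comp,
      Category.comp_id]⟩
  map_id A := SObject.Hom.ext (F.map_id A)
  map_comp f g := SObject.Hom.ext (F.map_comp f g)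

variable (R S)

/-- An `R`-linear functor `F : D ⥤ C` from an `S`-linear abelian category to an `R`-linear abelian
category is an `R`-deformation of `D` if it induces an equivalence `D ⥤ C_S`. -/
structure IsDeformation (F : D ⥤ C) : Prop where
  linear : IsLinearOver R S F
  isEquivalence : linear.toSObject.IsEquivalence

end Deformation

/-!
Let `a` be the kernel of `R → S`. The functor `F` identifies `D` with the full subcategory of the
objects of `C` that are annihilated by `a`, which is closed under subobjects and quotients, and the
nilpotence of `a` makes each object of `C` an iterated extension of such objects. Flatness enters
only through the following lifting property, from which Grothendieck's axioms follow by dévissage.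

**Lifting of injective objects** (`exists_injective_lift`). An object `J` that is injective among
those annihilated by an ideal `a` is the `a`-torsion of an object `E` that is injective among those
annihilated by `a²` (`exists_injectiveFor_sq`); this is then iterated along `a, a², a⁴, …`. If
`K` represents `X ↦ Hom_R(a, C(X, J))`, then `E` has to be an extension of `K` by `J` on which `a`
acts through the evaluations `K → J`. The universal map `a → C(K, J)` defines a class in
`Ext¹_R(R/a, C(K, J))`, which weak effaceability kills after an epimorphism `A → K` and a
monomorphism `J → B`; the extension `E` is a pushout of `A`.

**Limits and colimits.** As `D` has enough injectives, so has `C`. The product of injective objects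
is the lift of the product of their torsion subobjects, so that products exist in general, and the
lift of an injective coseparator of `D` is an injective coseparator of `C`. The special adjoint
functor theorem provides the colimits (`hasColimits_of_hasLimits_of_isCoseparating`).

**Exactness of filtered colimits.** With enough injectives it suffices that `lim¹ Hom(Z, E)`
vanishes for each filtered diagram `Z` and each injective `E`
(`hasExactColimitsOfShape_of_cocyclesBound`). By dévissage `Z` may be taken in `D`, where this
follows from the exactness of filtered colimits.

**Separator.** For each `T` there is an object `Z` such that each epimorphism `P → T` remains epi
after composition with some `Z → P` (`exists_cover_of_kernel_killed_by_pow`). If the kernel is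
annihilated by `a`, then `a P` is a quotient of a finite power of `T`, and a suitable subobject of
`P` is an extension of an object of `D` of bounded size by `a P`. For `T` the image of a separator
of `D`, Nakayama's lemma shows that `Z` is a separator of `C`.
-/

namespace FlatDeformation

/-! ### Objects annihilated by an ideal -/

section Killed

variable {R : Type w} [CommRing R] {C : Type u} [Category.{v} C] [Abelian C] [Linear R C]

/-- The object `X` is annihilated by the ideal `a`. -/
def KilledBy (a : Ideal R) (X : C) : Prop := ∀ r ∈ a, r • 𝟙 X = 0

lemma KilledBy.smul_from {a : Ideal R} {X Y : C} (h : KilledBy a X) (f : X ⟶ Y) {r : R}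
    (hr : r ∈ a) : r • f = 0 := by
  rw [← Category.id_comp f, ← Linear.smul_comp, h r hr, zero_comp]

lemma KilledBy.smul_to {a : Ideal R} {X Y : C} (h : KilledBy a Y) (f : X ⟶ Y) {r : R}
    (hr : r ∈ a) : r • f = 0 := by
  rw [← Category.comp_id f, ← Linear.comp_smul, h r hr, comp_zero]

lemma KilledBy.of_mono {a : Ideal R} {X Y : C} (h : KilledBy a Y) (f : X ⟶ Y) [Mono f] :
    KilledBy a X := fun r hr => by
  rw [← cancel_mono f, Linear.smul_comp, Category.id_comp, h.smul_to f hr, zero_comp]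

lemma KilledBy.of_epi {a : Ideal R} {X Y : C} (h : KilledBy a X) (f : X ⟶ Y) [Epi f] :
    KilledBy a Y := fun r hr => by
  rw [← cancel_epi f, Linear.comp_smul, Category.comp_id, h.smul_from f hr, comp_zero]

lemma KilledBy.mono {a b : Ideal R} (hab : a ≤ b) {X : C} (h : KilledBy b X) : KilledBy a X :=
  fun r hr => h r (hab hr)

/-- The object representing `A ↦ Hom_R(M, C(A, J))` for a finitely presented module `M`: a finite
limit of copies of `J`. -/
lemma exists_homObject (M : Type w) [AddCommGroup M] [Module R M] [Module.FinitePresentation R M]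
    (J : C) : ∃ (K : C) (ev : M →ₗ[R] (K ⟶ J)),
      (∀ (A : C) (φ : M →ₗ[R] (A ⟶ J)), ∃ g : A ⟶ K, ∀ m, g ≫ ev m = φ m) ∧
      (∀ (A : C) (g : A ⟶ K), (∀ m, g ≫ ev m = 0) → g = 0) := by
  obtain ⟨n, k, f, g, hf, hfg⟩ := Module.FinitePresentation.exists_fin' R M
  let π (i : Fin n) : (∏ᶜ fun _ : Fin n => J) ⟶ J := Pi.π _ i
  let d : (∏ᶜ fun _ : Fin n => J) ⟶ (∏ᶜ fun _ : Fin k => J) :=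
    Pi.lift fun l => ∑ i, g (Pi.single l 1) i • π i
  let e : (Fin n → R) →ₗ[R] (kernel d ⟶ J) :=
    { toFun := fun c => kernel.ι d ≫ ∑ i, c i • π i
      map_add' := fun c c' => by simp [add_smul, Finset.sum_add_distrib]
      map_smul' := fun r c => by
        simp only [Pi.smul_apply, smul_eq_mul, mul_smul, ← Finset.smul_sum, Linear.comp_smul]
        rfl }
  have he : LinearMap.ker f ≤ LinearMap.ker e := by
    rw [LinearMap.exact_iff.mp hfg, LinearMap.range_le_ker_iff]
    refine LinearMap.pi_ext' fun l => LinearMap.ext_ring ?_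
    have h := kernel.condition d =≫ Pi.π _ l
    rwa [Category.assoc, zero_comp, Pi.lift_π] at h
  let ev : M →ₗ[R] (kernel d ⟶ J) :=
    ((LinearMap.ker f).liftQ e he).comp (f.quotKerEquivOfSurjective hf).symm.toLinearMap
  have hev (c : Fin n → R) : ev (f c) = e c := by
    have : (f.quotKerEquivOfSurjective hf).symm (f c) = Submodule.Quotient.mk c := by
      rw [LinearEquiv.symm_apply_eq]; rfl
    simp [ev, this]
  have hei (i : Fin n) : e (Pi.single i 1) = kernel.ι d ≫ π i := by
    simp [e, Pi.single_apply, ite_smul]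
  refine ⟨kernel d, ev, fun A φ => ?_, fun A x hx => ?_⟩
  · have hπ (c : Fin n → R) :
        Pi.lift (fun i => φ (f (Pi.single i 1))) ≫ ∑ i, c i • π i = φ (f c) := by
      conv_rhs => rw [pi_eq_sum_univ' c]
      simp [π, Preadditive.comp_sum, map_sum]
    refine ⟨kernel.lift d (Pi.lift fun i => φ (f (Pi.single i 1))) ?_, fun m => ?_⟩
    · refine Pi.hom_ext _ _ fun l => ?_
      have := hπ (g (Pi.single l 1))
      rw [hfg.apply_apply_eq_zero, map_zero] at this
      simpa [d] using this
    · obtain ⟨c, rfl⟩ := hf m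
      rw [hev]
      simp only [e, LinearMap.coe_mk, AddHom.coe_mk]
      rw [kernel.lift_ι_assoc, hπ]
  · rw [← cancel_mono (kernel.ι d), zero_comp]
    refine Pi.hom_ext _ _ fun i => ?_
    have := hx (f (Pi.single i 1))
    rw [hev, hei] at this
    simpa using this

/-- The largest subobject of `X` annihilated by a finitely generated ideal. -/
lemma exists_torsion {a : Ideal R} (ha : a.FG) (X : C) : ∃ (T : C) (τ : T ⟶ X), Mono τ ∧
    KilledBy a T ∧ ∀ (W : C) (f : W ⟶ X), (∀ r ∈ a, r • f = 0) → ∃ g : W ⟶ T, g ≫ τ = f := by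
  have : Module.FinitePresentation R (R ⧸ a) :=
    Module.finitePresentation_of_surjective a.mkQ (Submodule.mkQ_surjective a)
      (by rwa [Submodule.ker_mkQ])
  obtain ⟨K, ev, h1, h2⟩ := exists_homObject (R := R) (R ⧸ a) X
  have hev (m : R) : ev (Submodule.Quotient.mk m) = m • ev (Submodule.Quotient.mk 1) := by
    rw [← map_smul, ← Submodule.Quotient.mk_smul, smul_eq_mul, mul_one]
  have key (A : C) (g : A ⟶ K) (hg : g ≫ ev (Submodule.Quotient.mk 1) = 0) : g = 0 := by
    refine h2 A g fun m => ?_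
    obtain ⟨m, rfl⟩ := Submodule.Quotient.mk_surjective _ m
    rw [hev, Linear.comp_smul, hg, smul_zero]
  refine ⟨K, ev (Submodule.Quotient.mk 1), Preadditive.mono_of_cancel_zero _ (fun g => key _ g),
    fun r hr => key _ _ ?_, fun W f hf => ?_⟩
  · rw [Linear.smul_comp, Category.id_comp, ← hev,
      (Submodule.Quotient.mk_eq_zero a).mpr hr, map_zero]
  · obtain ⟨g, hg⟩ := h1 W (a.liftQ (LinearMap.toSpanSingleton R _ f)
      (fun r hr => by simpa using hf r hr))
    exact ⟨g, by rw [hg]; exact one_smul R f⟩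

/-- Nilpotence, used by descending induction on the powers of the ideal that annihilate `X`. -/
lemma isZero_of_isNilpotent {a : Ideal R} (hn : IsNilpotent a) {X : C}
    (h : ∀ f : X ⟶ X, (∀ r ∈ a, r • f = 0) → f = 0) : IsZero X := by
  obtain ⟨n, hn⟩ := hn
  have key (k : ℕ) : ∀ r ∈ a ^ (n - k), r • 𝟙 X = 0 := by
    induction k with
    | zero => intro r hr; rw [Nat.sub_zero, hn] at hr; simp [(Submodule.mem_bot R).mp hr]
    | succ k ih =>
      refine fun r hr => h _ fun s hs => ?_
      rw [smul_smul]
      refine ih _ (Ideal.pow_le_pow_right (n := n - (k + 1) + 1) (by omega) ?_)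
      rw [pow_succ']
      exact Ideal.mul_mem_mul hs hr
  rw [IsZero.iff_id_eq_zero, ← one_smul R (𝟙 X)]
  exact key n 1 (by simp)

/-- Nakayama's lemma for a nilpotent ideal, in terms of maps to annihilated objects. -/
lemma isZero_of_maps_to_killed {a : Ideal R} (ha : a.FG) (hn : IsNilpotent a) {X : C}
    (h : ∀ (W : C) (f : X ⟶ W), KilledBy a W → f = 0) : IsZero X := by
  obtain ⟨T, τ, _, hT, hτ⟩ := exists_torsion ha X
  refine isZero_of_isNilpotent hn fun f hf => ?_
  obtain ⟨g, rfl⟩ := hτ X f hf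
  rw [h _ g hT, zero_comp]

/-- An object without nonzero maps from objects annihilated by a nilpotent ideal vanishes. -/
lemma isZero_of_maps_from_killed {a : Ideal R} (ha : a.FG) (hn : IsNilpotent a) {X : C}
    (h : ∀ (W : C) (f : W ⟶ X), KilledBy a W → f = 0) : IsZero X := by
  obtain ⟨T, τ, _, hT, hτ⟩ := exists_torsion ha X
  refine isZero_of_isNilpotent hn fun f hf => ?_
  obtain ⟨g, rfl⟩ := hτ X f hf
  rw [h _ τ hT, comp_zero]

end Killed

/-! ### Flatness -/

section Flat

variable {R : Type w} [CommRing R] {C : Type u} [Category.{v} C] [Abelian C] [Linear R C]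

variable (C) in
/-- The part of flatness used below: after restriction along an epimorphism and a
monomorphism, each linear map `a → C(A, B)` becomes `r ↦ r • h` for some morphism `h`. This says
that the bifunctor `Ext¹_R(R/a, C(-,-))` is weakly effaceable. -/
def ExtendsLocally (a : Ideal R) : Prop :=
  ∀ (A B : C) (φ : a →ₗ[R] (A ⟶ B)), ∃ (A' B' : C) (p : A' ⟶ A) (j : B ⟶ B') (h : A' ⟶ B'),
    Epi p ∧ Mono j ∧ ∀ r : a, p ≫ φ r ≫ j = (r : R) • h

end Flat

/-- The class of `φ : a → C(A, B)` in `Ext¹_R(R/a, C(A, B))` is the obstruction to extending `φ`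
to `R`. -/
lemma extendsLocally_of_isFlatAbelian {R : Type w} [CommRing R] {C : Type u} [Category.{w} C]
    [Abelian C] [Linear R C] (h : IsFlatAbelian R C) {a : Ideal R} (ha : a.FG) :
    ExtendsLocally C a := by
  intro A B φ
  have : Module.FinitePresentation R (R ⧸ a) :=
    Module.finitePresentation_of_surjective a.mkQ (Submodule.mkQ_surjective a)
      (by rwa [Submodule.ker_mkQ])
  let S : ShortComplex (ModuleCat.{w} R) :=
    ShortComplex.mk (ModuleCat.ofHom a.subtype) (ModuleCat.ofHom a.mkQ) (by
      ext x
      exact (Submodule.Quotient.mk_eq_zero a).mpr x.2)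
  have hS : S.ShortExact :=
    { exact := by
        rw [ShortComplex.moduleCat_exact_iff]
        intro x hx
        exact ⟨⟨x, (Submodule.Quotient.mk_eq_zero a).mp hx⟩, rfl⟩
      mono_f := (ModuleCat.mono_iff_injective _).mpr Subtype.val_injective
      epi_g := (ModuleCat.epi_iff_surjective _).mpr (Submodule.mkQ_surjective a) }
  let φ' : S.X₁ ⟶ ModuleCat.of R (A ⟶ B) := ModuleCat.ofHom φ
  obtain ⟨⟨A', B'⟩, ⟨p, j⟩, hi, hx⟩ := h (ModuleCat.of R (R ⧸ a)) this (Opposite.op A, B)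
    (hS.extClass.comp (Abelian.Ext.mk₀ φ') (add_zero 1))
  let q : ModuleCat.of R (A ⟶ B) ⟶ ModuleCat.of R (A'.unop ⟶ B') :=
    (Functor.uncurry.obj (linearCoyoneda R C)).map (X := (Opposite.op A, B)) (Y := (A', B')) (p, j)
  have hq : hS.extClass.comp (Abelian.Ext.mk₀ (φ' ≫ q)) (add_zero 1) = 0 := by
    rw [← Abelian.Ext.mk₀_comp_mk₀, ← Abelian.Ext.comp_assoc_of_third_deg_zero]
    exact hx
  obtain ⟨y, hy⟩ := Abelian.Ext.contravariant_sequence_exact₁ hS _ _ _ hq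
  obtain ⟨y, rfl⟩ := Abelian.Ext.homEquiv₀.symm.surjective y
  have hp : Mono p := ⟨fun {Z} g g' hg => by
    let x : (Z, B) ⟶ (Opposite.op A, B) := (g, 𝟙 B)
    let x' : (Z, B) ⟶ (Opposite.op A, B) := (g', 𝟙 B)
    have h : x = x' := (cancel_mono (p, j)).mp (Prod.ext hg rfl)
    exact congr_arg Prod.fst h⟩
  have hj : Mono j := ⟨fun {Z} g g' hg => by
    let x : (Opposite.op A, Z) ⟶ (Opposite.op A, B) := (𝟙 _, g)
    let x' : (Opposite.op A, Z) ⟶ (Opposite.op A, B) := (𝟙 _, g')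
    have h : x = x' := (cancel_mono (p, j)).mp (Prod.ext rfl hg)
    exact congr_arg Prod.snd h⟩
  refine ⟨A'.unop, B', p.unop, j, y.hom (1 : R), inferInstance, hj, fun r => ?_⟩
  have hr : y.hom (r : R) = (p.unop ≫ φ r) ≫ j := congr_arg (fun z => ModuleCat.Hom.hom z r)
    ((Abelian.Ext.mk₀_bijective _ _).injective ((Abelian.Ext.mk₀_comp_mk₀ _ _).symm.trans hy))
  rw [← Category.assoc, ← hr, ← map_smul, smul_eq_mul, mul_one]

/-! ### Lifting injective objects -/

section Lift

variable {R : Type w} [CommRing R] {C : Type u} [Category.{v} C] [Abelian C] [Linear R C]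

/-- `J` is annihilated by `a` and injective among the objects annihilated by `a`. -/
structure IsInjectiveFor (a : Ideal R) (J : C) : Prop where
  killed : KilledBy a J
  factors : ∀ {X Y : C} (f : X ⟶ Y) [Mono f], KilledBy a Y → ∀ g : X ⟶ J, ∃ h : Y ⟶ J, f ≫ h = g

/-- The pushout of the extension `0 → kernel p → A → K → 0` along `s : kernel p ⟶ J`. -/
lemma exists_pushout_extension {A K J : C} (p : A ⟶ K) [Epi p] (s : kernel p ⟶ J) :
    ∃ (E : C) (t : A ⟶ E) (i : J ⟶ E) (q : E ⟶ K) (w : i ≫ q = 0),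
      (ShortComplex.mk i q w).ShortExact ∧ t ≫ q = p ∧ kernel.ι p ≫ t = s ≫ i ∧
      ∀ (Z : C) (x : A ⟶ Z) (y : J ⟶ Z), kernel.ι p ≫ x = s ≫ y →
        ∃ e : E ⟶ Z, t ≫ e = x ∧ i ≫ e = y := by
  let t : A ⟶ pushout (kernel.ι p) s := pushout.inl _ _
  let i : J ⟶ pushout (kernel.ι p) s := pushout.inr _ _
  let q : pushout (kernel.ι p) s ⟶ K := pushout.desc p 0 (by simp)
  have htq : t ≫ q = p := pushout.inl_desc _ _ _
  have hiq : i ≫ q = 0 := pushout.inr_desc _ _ _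
  have ht : kernel.ι p ≫ t = s ≫ i := pushout.condition
  have hp := Abelian.epiIsCokernelOfKernel _ (kernelIsKernel p)
  have hq : Epi q := by
    have : Epi (t ≫ q) := by rw [htq]; infer_instance
    exact epi_of_epi t q
  refine ⟨_, t, i, q, hiq, ⟨ShortComplex.exact_of_g_is_cokernel _ ?_⟩, htq, ht,
    fun Z x y h => ⟨pushout.desc x y h, pushout.inl_desc _ _ _, pushout.inr_desc _ _ _⟩⟩
  refine CokernelCofork.IsColimit.ofπ' _ _ fun {Z} f hf => ?_
  replace hf : i ≫ f = 0 := hf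
  have hk : kernel.ι p ≫ t ≫ f = 0 := by rw [reassoc_of% ht, hf, comp_zero]
  have hd : p ≫ hp.desc (CokernelCofork.ofπ (t ≫ f) hk) = t ≫ f :=
    hp.fac _ WalkingParallelPair.one
  refine ⟨hp.desc (CokernelCofork.ofπ (t ≫ f) hk), pushout.hom_ext ?_ ?_⟩
  · exact (reassoc_of% htq) _ |>.trans hd
  · exact (reassoc_of% hiq) _ |>.trans (zero_comp.trans hf.symm)

/-- Injectivity of an extension `0 → J → E → K → 0`, where `K` represents `Hom_R(a, J)` and the
elements `r` of `a` act on `E` through `ev r : K → J`. Given an embedding of `E` into `P`, the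
inclusion of `J` is retracted twice, on the `a`-torsion of `P` and on the kernel of the induced map
to `K`; dividing by the kernels of the retractions leaves a quotient `Q` of `P` that is an extension
of `K` by `J`, so that `E → Q` is an isomorphism. -/
lemma exists_retraction_of_universal_extension {a : Ideal R} (ha : a.FG) {J K E : C}
    (hJ : IsInjectiveFor a J) (ev : a →ₗ[R] (K ⟶ J))
    (hev : ∀ (A : C) (φ : a →ₗ[R] (A ⟶ J)), ∃ g : A ⟶ K, ∀ r, g ≫ ev r = φ r)
    (hev' : ∀ (A : C) (g : A ⟶ K), (∀ r, g ≫ ev r = 0) → g = 0)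
    (i : J ⟶ E) (q : E ⟶ K) (w : i ≫ q = 0) (hE : (ShortComplex.mk i q w).ShortExact)
    (hmul : ∀ r : a, (r : R) • 𝟙 E = q ≫ ev r ≫ i)
    {P : C} (f : E ⟶ P) [Mono f] (hP : KilledBy (a * a) P) : ∃ g : P ⟶ E, f ≫ g = 𝟙 E := by
  have : Mono i := hE.mono_f
  have : Epi q := hE.epi_g
  obtain ⟨T, τ, _, hT, hτ⟩ := exists_torsion ha P
  obtain ⟨i', hi'⟩ := hτ J (i ≫ f) fun r hr => hJ.killed.smul_from _ hr
  have : Mono i' := mono_of_mono_fac hi'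
  obtain ⟨ρ, hρ⟩ := hJ.factors i' hT (𝟙 J)
  have hs (r : a) : ∃ s : P ⟶ T, s ≫ τ = (r : R) • 𝟙 P :=
    hτ P _ fun r' hr' => by rw [smul_smul, hP _ (Ideal.mul_mem_mul hr' r.2)]
  choose s hs using hs
  let ψ : a →ₗ[R] (P ⟶ J) :=
    { toFun := fun r => s r ≫ ρ
      map_add' := fun r r' => by
        rw [← Preadditive.add_comp]
        congr 1
        rw [← cancel_mono τ, Preadditive.add_comp, hs, hs, hs, Submodule.coe_add, add_smul]
      map_smul' := fun r r' => by
        rw [RingHom.id_apply, ← Linear.smul_comp]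
        congr 1
        rw [← cancel_mono τ, Linear.smul_comp, hs, hs, Submodule.coe_smul, smul_eq_mul, mul_smul] }
  obtain ⟨k, hk⟩ := hev P ψ
  have hψ (r : a) : ψ r = s r ≫ ρ := rfl
  have hfk : f ≫ k = q := by
    rw [← sub_eq_zero]
    refine hev' _ _ fun r => ?_
    have h1 : f ≫ s r = q ≫ ev r ≫ i' := by
      rw [← cancel_mono τ, Category.assoc, hs, Linear.comp_smul, Category.comp_id, Category.assoc,
        Category.assoc, hi', ← Category.id_comp f, ← Linear.smul_comp, hmul]
      simp
    rw [Preadditive.sub_comp, Category.assoc, hk, hψ, ← Category.assoc, h1, Category.assoc,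
      Category.assoc, hρ, Category.comp_id, sub_self]
  have hτs (r : a) : τ ≫ s r = 0 := by
    rw [← cancel_mono τ, Category.assoc, hs, Linear.comp_smul, Category.comp_id, zero_comp,
      hT.smul_from _ r.2]
  have hτk : τ ≫ k = 0 := hev' _ _ fun r => by
    rw [Category.assoc, hk, hψ, reassoc_of% hτs r, zero_comp]
  -- Divide `P` by the kernel of `ρ`, so that `a` acts through `K ⟶ J`.
  let u₁ : P ⟶ pushout τ ρ := pushout.inl τ ρ
  let v₁ : J ⟶ pushout τ ρ := pushout.inr τ ρ
  let k₁ : pushout τ ρ ⟶ K := pushout.desc k 0 (by rw [hτk, comp_zero])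
  have hu₁ : u₁ ≫ k₁ = k := pushout.inl_desc _ _ _
  have hv₁ : v₁ ≫ k₁ = 0 := pushout.inr_desc _ _ _
  have hτu₁ : τ ≫ u₁ = ρ ≫ v₁ := pushout.condition
  have : Epi ρ := epi_of_epi_fac hρ
  have : Epi u₁ := inferInstanceAs (Epi (pushout.inl τ ρ))
  have : Mono v₁ := inferInstanceAs (Mono (pushout.inr τ ρ))
  have hmul₁ (r : a) : (r : R) • 𝟙 (pushout τ ρ) = k₁ ≫ ev r ≫ v₁ := by
    rw [← cancel_epi u₁, reassoc_of% hu₁, reassoc_of% hk, hψ, Linear.comp_smul, Category.comp_id,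
      Category.assoc, ← hτu₁, reassoc_of% hs r, Linear.smul_comp, Category.id_comp]
  have : Epi k₁ := by
    have : Epi ((f ≫ u₁) ≫ k₁) := by rw [Category.assoc, hu₁, hfk]; infer_instance
    exact epi_of_epi (f ≫ u₁) k₁
  have hκ : KilledBy a (kernel k₁) := fun r hr => by
    rw [← cancel_mono (kernel.ι k₁), Linear.smul_comp, Category.id_comp, zero_comp,
      ← Category.comp_id (kernel.ι k₁), ← Linear.comp_smul, hmul₁ ⟨r, hr⟩, kernel.condition_assoc,
      zero_comp]
  -- The copy of `J` in the kernel of `k₁` is a direct summand; divide by a complement.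
  let v₁' : J ⟶ kernel k₁ := kernel.lift k₁ v₁ hv₁
  have hv₁' : v₁' ≫ kernel.ι k₁ = v₁ := kernel.lift_ι _ _ _
  have : Mono v₁' := mono_of_mono_fac hv₁'
  obtain ⟨σ, hσ⟩ := hJ.factors v₁' hκ (𝟙 J)
  obtain ⟨Q, u₂, v₂, k₂, hv₂, hQ, hu₂, hκu₂, -⟩ := exists_pushout_extension k₁ σ
  have hf₂ : i ≫ f ≫ u₁ ≫ u₂ = v₂ := by
    rw [← reassoc_of% hi', reassoc_of% hτu₁, reassoc_of% hρ, ← hv₁', Category.assoc, hκu₂,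
      reassoc_of% hσ]
  have hk₂ : (f ≫ u₁ ≫ u₂) ≫ k₂ = q := by
    rw [Category.assoc, Category.assoc, hu₂, hu₁, hfk]
  let α : ShortComplex.mk i q w ⟶ ShortComplex.mk v₂ k₂ hv₂ :=
    { τ₁ := 𝟙 J
      τ₂ := f ≫ u₁ ≫ u₂
      τ₃ := 𝟙 K
      comm₁₂ := by rw [hf₂]; exact Category.id_comp _
      comm₂₃ := by rw [hk₂]; exact (Category.comp_id _).symm }
  have : IsIso α.τ₁ := inferInstanceAs (IsIso (𝟙 J))
  have : IsIso α.τ₃ := inferInstanceAs (IsIso (𝟙 K))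
  have : IsIso α.τ₂ :=
    ShortComplex.isIso₂_of_shortExact_of_isIso₁₃' α hE hQ inferInstance inferInstance
  exact ⟨(u₁ ≫ u₂) ≫ inv α.τ₂, by rw [← Category.assoc]; exact IsIso.hom_inv_id α.τ₂⟩

/-- An object that is injective among those annihilated by `a` is the `a`-torsion of an object
that is injective among those annihilated by `a * a`. -/
lemma exists_injectiveFor_sq {a : Ideal R} [Module.FinitePresentation R a] (ha : a.FG)
    (hflat : ExtendsLocally C a) {J : C} (hJ : IsInjectiveFor a J) :
    ∃ (E : C) (i : J ⟶ E), Mono i ∧ IsInjectiveFor (a * a) E ∧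
      ∀ (X : C) (f : X ⟶ E), KilledBy a X → ∃ g : X ⟶ J, g ≫ i = f := by
  obtain ⟨K, ev, hev, hev'⟩ := exists_homObject (R := R) a J
  have hK : KilledBy a K := fun r hr => hev' _ _ fun s => by
    rw [Linear.smul_comp, Category.id_comp, hJ.killed.smul_to _ hr]
  obtain ⟨A, B, p, j, h, _, _, hφ⟩ := hflat K J ev
  obtain ⟨T, τ, _, hT, hτ⟩ := exists_torsion ha B
  obtain ⟨j', hj'⟩ := hτ J j fun r hr => hJ.killed.smul_from _ hr
  have : Mono j' := mono_of_mono_fac hj'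
  obtain ⟨ρ, hρ⟩ := hJ.factors j' hT (𝟙 J)
  obtain ⟨m, hm⟩ := hτ (kernel p) (kernel.ι p ≫ h) fun r hr => by
    rw [← Linear.comp_smul, ← hφ ⟨r, hr⟩, kernel.condition_assoc, zero_comp]
  -- `E` is the extension of `K` by `J` obtained from `A` by pushout along `kernel p ⟶ J`.
  obtain ⟨E, t, i, q, hiq, hE, htq, -, huniv⟩ := exists_pushout_extension p (m ≫ ρ)
  have : Mono i := hE.mono_f
  have : Epi q := hE.epi_g
  have hlift {X : C} (f : X ⟶ _) (hf : f ≫ q = 0) : ∃ g : X ⟶ J, g ≫ i = f :=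
    ⟨hE.exact.lift f hf, hE.exact.lift_f f hf⟩
  -- The quotient of `B` by the kernel of `ρ` receives a map from `E` that is monic on `J`.
  let v : J ⟶ pushout τ ρ := pushout.inr τ ρ
  have : Mono v := inferInstanceAs (Mono (pushout.inr τ ρ))
  obtain ⟨e, hte, hie⟩ := huniv _ (h ≫ pushout.inl τ ρ) v (by
    rw [← Category.assoc, ← hm, Category.assoc, Category.assoc, pushout.condition])
  have hmul (r : a) : (r : R) • 𝟙 E = q ≫ ev r ≫ i := by
    obtain ⟨g', hg'⟩ := hlift ((r : R) • 𝟙 _) (by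
      rw [Linear.smul_comp, Category.id_comp, hK.smul_to _ r.2])
    let g : K ⟶ J := hE.exact.desc g' (by
      change i ≫ g' = 0
      rw [← cancel_mono i, Category.assoc, hg', Linear.comp_smul, Category.comp_id, zero_comp]
      exact hJ.killed.smul_from _ r.2)
    have hg : q ≫ g = g' := hE.exact.g_desc _ _
    have hgev : g = ev r := by
      have hev : p ≫ ev r ≫ v = (r : R) • (h ≫ pushout.inl τ ρ) := by
        have := hφ r =≫ pushout.inl τ ρ
        rw [Category.assoc, Category.assoc, ← hj', Category.assoc, pushout.condition,
          reassoc_of% hρ, Linear.smul_comp] at this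
        exact this
      rw [← cancel_mono v, ← cancel_epi p, hev, ← hte, ← hie]
      conv_lhs => rw [← htq]
      rw [Category.assoc, reassoc_of% hg, reassoc_of% hg']
      simp
    rw [← hgev, reassoc_of% hg, hg']
  have hkill : KilledBy (a * a) E := fun r hr => by
    induction hr using Submodule.mul_induction_on' with
    | mem_mul_mem r hr s hs =>
      rw [mul_smul, hmul ⟨s, hs⟩, ← Linear.comp_smul, ← Linear.comp_smul, hJ.killed.smul_from i hr,
        comp_zero, comp_zero]
    | add r _ s _ hr hs => rw [add_smul, hr, hs, add_zero]
  refine ⟨_, i, inferInstance, ⟨hkill, fun {X Y} f _ hY g => ?_⟩, fun X f hX => ?_⟩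
  · have hPO : KilledBy (a * a) (pushout f g) := fun r hr => by
      refine pushout.hom_ext ?_ ?_
      · rw [Linear.comp_smul, hY.smul_from _ hr, comp_zero]
      · rw [Linear.comp_smul, hkill.smul_from _ hr, comp_zero]
    obtain ⟨g', hg'⟩ := exists_retraction_of_universal_extension ha hJ ev hev hev' i q hiq hE hmul
      (pushout.inr f g) hPO
    exact ⟨pushout.inl f g ≫ g', by rw [pushout.condition_assoc, hg', Category.comp_id]⟩
  · refine hlift f (hev' _ _ fun r => ?_)
    rw [← cancel_mono i, zero_comp, Category.assoc, Category.assoc, ← hmul, Linear.comp_smul,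
      hX.smul_from _ r.2]

/-- Lifting of injective objects along a nilpotent ideal. -/
lemma exists_injective_lift {a : Ideal R} (hn : IsNilpotent a) (ha : a.FG)
    (hfp : ∀ b : Ideal R, b.FG → Module.FinitePresentation R b)
    (hflat : ∀ b : Ideal R, b.FG → ExtendsLocally C b) {J : C} (hJ : IsInjectiveFor a J) :
    ∃ (E : C) (i : J ⟶ E), Mono i ∧ Injective E ∧
      ∀ (X : C) (f : X ⟶ E), KilledBy a X → ∃ g : X ⟶ J, g ≫ i = f := by
  have key (k : ℕ) : ∃ (E : C) (i : J ⟶ E), Mono i ∧ IsInjectiveFor (a ^ 2 ^ k) E ∧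
      ∀ (X : C) (f : X ⟶ E), KilledBy a X → ∃ g : X ⟶ J, g ≫ i = f := by
    induction k with
    | zero => exact ⟨J, 𝟙 J, inferInstance, by simpa using hJ, fun X f _ => ⟨f, by simp⟩⟩
    | succ k ih =>
      obtain ⟨E, i, _, hE, h⟩ := ih
      have hb : (a ^ 2 ^ k).FG := ha.pow
      have := hfp _ hb
      obtain ⟨E', i', _, hE', h'⟩ := exists_injectiveFor_sq hb (hflat _ hb) hE
      refine ⟨E', i ≫ i', mono_comp _ _, by rwa [pow_succ 2, pow_mul, pow_two], fun X f hX => ?_⟩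
      obtain ⟨g', rfl⟩ := h' X f (hX.mono (Ideal.pow_le_self (by positivity)))
      obtain ⟨g, rfl⟩ := h X g' hX
      exact ⟨g, (Category.assoc _ _ _).symm⟩
  obtain ⟨n, hn⟩ := hn
  obtain ⟨E, i, hi, hE, h⟩ := key n
  refine ⟨E, i, hi, ⟨fun {X Y} g f _ => hE.factors f (fun r hr => ?_) g⟩, h⟩
  rw [pow_eq_zero_of_le Nat.lt_two_pow_self.le hn] at hr
  rw [(Submodule.mem_bot R).mp hr, zero_smul]

end Lift

/-! ### Dévissage -/

section Devissage

variable {R : Type w} [CommRing R] {C : Type u} [Category.{v} C] [Abelian C] [Linear R C]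

lemma KilledBy.of_torsion_quotient {a : Ideal R} {k : ℕ} {T X Q : C} {τ : T ⟶ X} {π : X ⟶ Q}
    [Epi π] (w : τ ≫ π = 0) (hX : KilledBy (a ^ (k + 1)) X)
    (hτ : ∀ (W : C) (f : W ⟶ X), (∀ r ∈ a, r • f = 0) → ∃ g : W ⟶ T, g ≫ τ = f) :
    KilledBy (a ^ k) Q := fun r hr => by
  obtain ⟨g, hg⟩ := hτ X (r • 𝟙 X) fun s hs => by
    rw [smul_smul, hX _ (pow_succ' a k ▸ Ideal.mul_mem_mul hs hr)]
  rw [← cancel_epi π, Linear.comp_smul, Category.comp_id, comp_zero, ← Category.id_comp π,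
    ← Linear.smul_comp, ← hg, Category.assoc, w, comp_zero]

lemma KilledBy.isZero {X : C} (hX : KilledBy (⊤ : Ideal R) X) : IsZero X := by
  rw [IsZero.iff_id_eq_zero, ← one_smul R (𝟙 X)]
  exact hX 1 trivial

/-- Dévissage along a nilpotent ideal: a property of objects holds for all objects if it passes
from `Q` to the extensions of `Q` by annihilated objects. -/
lemma devissage {a : Ideal R} (ha : a.FG) (hn : IsNilpotent a) {P : C → Prop}
    (zero : ∀ X, IsZero X → P X)
    (step : ∀ (T X Q : C) (τ : T ⟶ X) (π : X ⟶ Q) (w : τ ≫ π = 0),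
      (ShortComplex.mk τ π w).ShortExact → KilledBy a T → P Q → P X) (X : C) : P X := by
  obtain ⟨n, hn⟩ := hn
  have key (k : ℕ) : ∀ X : C, KilledBy (a ^ k) X → P X := by
    induction k with
    | zero => exact fun X hX => zero X (KilledBy.isZero (by simpa using hX))
    | succ k ih =>
      intro X hX
      obtain ⟨T, τ, hτm, hT, hτ⟩ := exists_torsion ha X
      refine step T X (cokernel τ) τ (cokernel.π τ) (cokernel.condition τ) ⟨?_⟩ hT
        (ih _ (hX.of_torsion_quotient (cokernel.condition τ) hτ))
      exact ShortComplex.exact_of_g_is_cokernel _ (cokernelIsCokernel τ)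
  refine key n X fun r hr => ?_
  rw [hn] at hr
  rw [(Submodule.mem_bot R).mp hr, zero_smul]

end Devissage

/-! ### The subcategory of annihilated objects -/

section Inclusion

variable {R : Type w} [CommRing R] {C : Type u} [Category.{v} C] [Abelian C] [Linear R C]
  {D : Type u'} [Category.{v'} D]

/-- The essential image of the functor `F` consists of the objects annihilated by `a`. For a fully
faithful functor `F : D ⥤ C` this identifies `D` with the full subcategory of these objects. -/
structure IsKilledInclusion (a : Ideal R) (F : D ⥤ C) : Prop where
  killed : ∀ A, KilledBy a (F.obj A)
  exists_iso : ∀ X, KilledBy a X → ∃ A, Nonempty (F.obj A ≅ X)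

namespace IsKilledInclusion

variable {a : Ideal R} {F : D ⥤ C} [F.Full] [F.Faithful]

/-- The right adjoint sends an object to its `a`-torsion. -/
lemma isLeftAdjoint (hF : IsKilledInclusion a F) (ha : a.FG) : F.IsLeftAdjoint := by
  rw [isLeftAdjoint_iff_hasTerminal_costructuredArrow]
  intro X
  obtain ⟨T, τ, _, hT, hτ⟩ := exists_torsion ha X
  obtain ⟨A, ⟨e⟩⟩ := hF.exists_iso T hT
  refine IsTerminal.hasTerminal (X := CostructuredArrow.mk (Y := A) (e.hom ≫ τ)) ?_
  have h (Y : CostructuredArrow F X) := hτ _ Y.hom fun r hr =>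
    (hF.killed Y.left).smul_from _ hr
  refine IsTerminal.ofUniqueHom (fun Y => CostructuredArrow.homMk
    (F.preimage ((h Y).choose ≫ e.inv)) (by simpa using (h Y).choose_spec)) fun Y m => ?_
  ext
  apply F.map_injective
  rw [← cancel_mono e.hom, ← cancel_mono τ, Category.assoc]
  have := CostructuredArrow.w m
  dsimp at this ⊢
  simpa [this] using (h Y).choose_spec.symm

variable [Abelian D]

omit [Abelian D] in
lemma isInjectiveFor_obj (hF : IsKilledInclusion a F) (J : D) [Injective J] :
    IsInjectiveFor a (F.obj J) where
  killed := hF.killed J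
  factors {X Y} f _ hY g := by
    obtain ⟨A, ⟨eA⟩⟩ := hF.exists_iso X (hY.of_mono f)
    obtain ⟨B, ⟨eB⟩⟩ := hF.exists_iso Y hY
    let f' : A ⟶ B := F.preimage (eA.hom ≫ f ≫ eB.inv)
    have hf' : F.map f' = eA.hom ≫ f ≫ eB.inv := F.map_preimage _
    have : Mono (F.map f') := by rw [hf']; infer_instance
    have : Mono f' := F.mono_of_mono_map this
    refine ⟨eB.inv ≫ F.map (Injective.factorThru (F.preimage (eA.hom ≫ g)) f'), ?_⟩
    have : F.map f' ≫ F.map (Injective.factorThru (F.preimage (eA.hom ≫ g)) f') = eA.hom ≫ g := by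
      rw [← F.map_comp, Injective.comp_factorThru, F.map_preimage]
    rw [hf'] at this
    simpa using this

lemma preservesMonomorphisms (hF : IsKilledInclusion a F) : F.PreservesMonomorphisms where
  preserves {A B} f _ := by
    obtain ⟨N, ⟨e⟩⟩ := hF.exists_iso _ ((hF.killed A).of_mono (kernel.ι (F.map f)))
    have h : F.preimage (e.hom ≫ kernel.ι (F.map f)) = 0 := by
      rw [← cancel_mono f]
      apply F.map_injective
      simp
    have h' := congr_arg F.map h
    rw [F.map_preimage, F.map_zero] at h'
    exact Preadditive.mono_of_kernel_zero ((cancel_epi e.hom).mp (h'.trans comp_zero.symm))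

lemma preservesEpimorphisms (hF : IsKilledInclusion a F) : F.PreservesEpimorphisms where
  preserves {A B} f _ := by
    obtain ⟨N, ⟨e⟩⟩ := hF.exists_iso _ ((hF.killed B).of_epi (cokernel.π (F.map f)))
    have h : F.preimage (cokernel.π (F.map f) ≫ e.inv) = 0 := by
      rw [← cancel_epi f]
      apply F.map_injective
      simp
    have h' := congr_arg F.map h
    rw [F.map_preimage, F.map_zero] at h'
    exact Preadditive.epi_of_cokernel_zero ((cancel_mono e.inv).mp (h'.trans zero_comp.symm))

variable {G : C ⥤ D} (adj : F ⊣ G)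

omit [F.Faithful] in
lemma mono_counit (hF : IsKilledInclusion a F) (X : C) : Mono (adj.counit.app X) := by
  obtain ⟨N, ⟨e⟩⟩ := hF.exists_iso _ ((hF.killed (G.obj X)).of_mono (kernel.ι (adj.counit.app X)))
  have h : F.preimage (e.hom ≫ kernel.ι (adj.counit.app X)) = 0 := by
    apply (adj.homEquiv _ _).symm.injective
    simp [Adjunction.homEquiv_counit]
  have h' := congr_arg F.map h
  rw [F.map_preimage, F.map_zero] at h'
  exact Preadditive.mono_of_kernel_zero ((cancel_epi e.hom).mp (h'.trans comp_zero.symm))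

omit [Abelian D] [F.Full] [F.Faithful] in
lemma exists_lift_counit (hF : IsKilledInclusion a F) {W X : C} (hW : KilledBy a W) (f : W ⟶ X) :
    ∃ g : W ⟶ F.obj (G.obj X), g ≫ adj.counit.app X = f := by
  obtain ⟨A, ⟨e⟩⟩ := hF.exists_iso W hW
  exact ⟨e.inv ≫ F.map (adj.homEquiv _ _ (e.hom ≫ f)), by
    simp [← Adjunction.homEquiv_counit]⟩

end IsKilledInclusion

end Inclusion

/-! ### Injective objects and limits -/

section Limits

variable {R : Type w} [CommRing R] {C : Type u} [Category.{v} C] [Abelian C] [Linear R C]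
  {D : Type u'} [Category.{v'} D] [Abelian D]

variable (C) in
/-- Each object that is injective among the annihilated ones is the `a`-torsion of an injective
object. -/
def LiftsInjectives (a : Ideal R) : Prop := ∀ J : C, IsInjectiveFor a J →
  ∃ (E : C) (i : J ⟶ E), Mono i ∧ Injective E ∧
    ∀ (X : C) (f : X ⟶ E), KilledBy a X → ∃ g : X ⟶ J, g ≫ i = f

variable {a : Ideal R} {F : D ⥤ C} [F.Full] [F.Faithful]

/-- If `X` is an extension of `Q` by an annihilated object `T`, embeddings of `T` and `Q` into
injective objects combine to an embedding of `X`. -/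
lemma enoughInjectives (hF : IsKilledInclusion a F) (ha : a.FG) (hn : IsNilpotent a)
    (hC : LiftsInjectives C a) [EnoughInjectives D] : EnoughInjectives C := by
  have h : ∀ X : C, ∃ (E : C) (i : X ⟶ E), Injective E ∧ Mono i := by
    refine devissage ha hn (fun X hX => ⟨X, 𝟙 X, hX.injective, inferInstance⟩) ?_
    rintro T X Q τ π w hS hT ⟨E₂, i₂, _, _⟩
    have : Mono τ := hS.mono_f
    obtain ⟨A, ⟨e⟩⟩ := hF.exists_iso T hT
    have := hF.preservesMonomorphisms
    obtain ⟨E₁, i₁, _, _, -⟩ := hC _ (hF.isInjectiveFor_obj (Injective.under A))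
    let x : X ⟶ E₁ := Injective.factorThru (e.inv ≫ F.map (Injective.ι A) ≫ i₁) τ
    have hx : τ ≫ x = e.inv ≫ F.map (Injective.ι A) ≫ i₁ := Injective.comp_factorThru _ _
    refine ⟨E₁ ⊞ E₂, biprod.lift x (π ≫ i₂), inferInstance,
      Preadditive.mono_of_cancel_zero _ fun {W} y hy => ?_⟩
    have h1 : y ≫ x = 0 := by simpa using hy =≫ biprod.fst
    have h2 : y ≫ π = 0 := by
      rw [← cancel_mono i₂]; simpa using hy =≫ biprod.snd
    obtain ⟨y, rfl⟩ : ∃ z : W ⟶ T, z ≫ τ = y := ⟨hS.exact.lift y h2, hS.exact.lift_f y h2⟩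
    rw [Category.assoc, hx] at h1
    rw [(cancel_mono (e.inv ≫ F.map (Injective.ι A) ≫ i₁)).mp (h1.trans zero_comp.symm),
      zero_comp]
  exact ⟨fun X => by
    obtain ⟨E, i, hE, hi⟩ := h X
    exact ⟨⟨E, hE, i, hi⟩⟩⟩

/-- The product of injective objects `E i` is the injective object whose torsion is the product of
the torsion subobjects of the `E i`. -/
lemma hasProduct_of_injective (hF : IsKilledInclusion a F) (ha : a.FG) (hn : IsNilpotent a)
    (hC : LiftsInjectives C a) {ι : Type w} [HasProductsOfShape ι D] (E : ι → C)
    [∀ i, Injective (E i)] : HasProduct E := by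
  have := hF.isLeftAdjoint ha
  obtain ⟨G, ⟨adj⟩⟩ := this.exists_rightAdjoint
  have := hF.preservesMonomorphisms
  have (i : ι) : Injective (G.obj (E i)) := adj.map_injective _ inferInstance
  let N : D := ∏ᶜ fun i => G.obj (E i)
  obtain ⟨P, j, _, _, hj⟩ := hC _ (hF.isInjectiveFor_obj N)
  let p (i : ι) : P ⟶ E i :=
    Injective.factorThru (F.map (Pi.π (fun i => G.obj (E i)) i) ≫ adj.counit.app (E i)) j
  have hp (i : ι) : j ≫ p i = F.map (Pi.π (fun i => G.obj (E i)) i) ≫ adj.counit.app (E i) :=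
    Injective.comp_factorThru _ _
  -- A morphism from an annihilated object to `P` is a map to `N`, and similarly for the `E i`.
  have inj_killed (T : C) (hT : KilledBy a T) (f : T ⟶ P) (hf : ∀ i, f ≫ p i = 0) : f = 0 := by
    obtain ⟨f, rfl⟩ := hj T f hT
    obtain ⟨A, ⟨e⟩⟩ := hF.exists_iso T hT
    have h : F.preimage (e.hom ≫ f) = 0 := by
      refine Pi.hom_ext _ _ fun i => ?_
      have := hF.mono_counit adj (E i)
      apply F.map_injective
      rw [← cancel_mono (adj.counit.app (E i)), F.map_comp, F.map_preimage, Category.assoc, ← hp,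
        zero_comp, F.map_zero, zero_comp, Category.assoc, ← Category.assoc f, hf, comp_zero]
    have h' := congr_arg F.map h
    rw [F.map_preimage, F.map_zero] at h'
    rw [(cancel_epi e.hom).mp (h'.trans comp_zero.symm), zero_comp]
  have surj_killed (T : C) (hT : KilledBy a T) (f : ∀ i, T ⟶ E i) :
      ∃ g : T ⟶ P, ∀ i, g ≫ p i = f i := by
    obtain ⟨A, ⟨e⟩⟩ := hF.exists_iso T hT
    refine ⟨e.inv ≫ F.map (Pi.lift fun i => adj.homEquiv _ _ (e.hom ≫ f i)) ≫ j, fun i => ?_⟩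
    rw [Category.assoc, Category.assoc, hp, ← F.map_comp_assoc, Pi.lift_π,
      ← Adjunction.homEquiv_counit, Equiv.symm_apply_apply, Iso.inv_hom_id_assoc]
  have key : ∀ X : C, (∀ f : X ⟶ P, (∀ i, f ≫ p i = 0) → f = 0) ∧
      ∀ f : ∀ i, X ⟶ E i, ∃ g : X ⟶ P, ∀ i, g ≫ p i = f i := by
    refine devissage ha hn (fun X hX => ⟨fun f _ => hX.eq_of_src _ _,
      fun f => ⟨0, fun i => hX.eq_of_src _ _⟩⟩) ?_
    rintro T X Q τ π w hS hT ⟨hQ₁, hQ₂⟩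
    have : Mono τ := hS.mono_f
    have : Epi π := hS.epi_g
    have desc {Z : C} (f : X ⟶ Z) (hf : τ ≫ f = 0) : ∃ g : Q ⟶ Z, π ≫ g = f :=
      ⟨hS.exact.desc f hf, hS.exact.g_desc f hf⟩
    refine ⟨fun f hf => ?_, fun f => ?_⟩
    · obtain ⟨g, rfl⟩ := desc f (inj_killed T hT _ fun i => by rw [Category.assoc, hf, comp_zero])
      rw [hQ₁ g fun i => by rw [← cancel_epi π, ← Category.assoc, hf, comp_zero], comp_zero]
    · obtain ⟨g, hg⟩ := surj_killed T hT fun i => τ ≫ f i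
      let g' : X ⟶ P := Injective.factorThru g τ
      have hg' : τ ≫ g' = g := Injective.comp_factorThru _ _
      choose d hd using fun i => desc (f i - g' ≫ p i) (by
        rw [Preadditive.comp_sub, reassoc_of% hg', hg, sub_self])
      obtain ⟨q, hq⟩ := hQ₂ d
      exact ⟨g' + π ≫ q, fun i => by simp [hq, hd]⟩
  refine ⟨⟨⟨Fan.mk P p, Fan.IsLimit.mk _ (fun s => ((key s.pt).2 s.proj).choose)
    (fun s i => ((key s.pt).2 s.proj).choose_spec i) fun s m hm => ?_⟩⟩⟩
  rw [← sub_eq_zero]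
  refine (key s.pt).1 _ fun i => ?_
  rw [Preadditive.sub_comp, ((key s.pt).2 s.proj).choose_spec i, sub_eq_zero]
  exact hm i

/-- An object is the kernel of a morphism between injective objects, and the kernel of a product of
morphisms is the product of their kernels. -/
lemma hasProduct_of_injective_copresentation [EnoughInjectives C] {ι : Type w}
    (h : ∀ (E : ι → C) [∀ i, Injective (E i)], HasProduct E) (X : ι → C) : HasProduct X := by
  let E₀ (i : ι) : C := Injective.under (X i)
  let E₁ (i : ι) : C := Injective.under (cokernel (Injective.ι (X i)))
  let d (i : ι) : E₀ i ⟶ E₁ i := cokernel.π (Injective.ι (X i)) ≫ Injective.ι _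
  have hd (i : ι) : Injective.ι (X i) ≫ d i = 0 := by simp [d]
  have lift {W : C} (i : ι) (f : W ⟶ E₀ i) (hf : f ≫ d i = 0) :
      ∃ g : W ⟶ X i, g ≫ Injective.ι (X i) = f := by
    have hf' : f ≫ cokernel.π (Injective.ι (X i)) = 0 := by
      rw [← cancel_mono (Injective.ι (cokernel (Injective.ι (X i)))), Category.assoc, zero_comp]
      exact hf
    exact ⟨Abelian.monoLift (Injective.ι (X i)) f hf', Abelian.monoLift_comp _ _ _⟩
  have := h E₀
  have := h E₁
  let k := kernel.ι (Limits.Pi.map d)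
  have hk (i : ι) : (k ≫ Pi.π E₀ i) ≫ d i = 0 := by
    have := kernel.condition (Limits.Pi.map d) =≫ Pi.π E₁ i
    rwa [Category.assoc, Pi.map_π, zero_comp, ← Category.assoc] at this
  choose p hp using fun i => lift i (k ≫ Pi.π E₀ i) (hk i)
  have hl (s : Fan X) : Pi.lift (fun i => s.proj i ≫ Injective.ι (X i)) ≫ Limits.Pi.map d = 0 := by
    refine Pi.hom_ext _ _ fun i => ?_
    simp [hd]
  refine ⟨⟨⟨Fan.mk _ p, Fan.IsLimit.mk _ (fun s => kernel.lift _ _ (hl s))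
    (fun s i => ?_) fun s m hm => ?_⟩⟩⟩
  · rw [← cancel_mono (Injective.ι (X i)), Category.assoc]
    change _ ≫ p i ≫ _ = _
    rw [hp, kernel.lift_ι_assoc, Pi.lift_π]
  · rw [← cancel_mono (kernel.ι _), kernel.lift_ι]
    refine Pi.hom_ext _ _ fun i => ?_
    rw [Pi.lift_π, ← hm, Category.assoc, Category.assoc]
    exact congr_arg (m ≫ ·) (hp i).symm

/-- An injective lift of an injective coseparator of `D` is a coseparator, since a nonzero object
has a nonzero annihilated subobject. -/
lemma exists_injective_coseparator (hF : IsKilledInclusion a F) (ha : a.FG) (hn : IsNilpotent a)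
    (hC : LiftsInjectives C a) {J : D} [Injective J] (hJ : IsCoseparator J) :
    ∃ E : C, Injective E ∧ IsCoseparator E := by
  obtain ⟨E, j, _, _, -⟩ := hC _ (hF.isInjectiveFor_obj J)
  refine ⟨E, inferInstance, (Preadditive.isCoseparator_iff _).mpr fun X Y f hf => ?_⟩
  have hι (h : Y ⟶ E) : Abelian.image.ι f ≫ h = 0 := by
    rw [← cancel_epi (Abelian.factorThruImage f), ← Category.assoc, Abelian.image.fac,
      hf, comp_zero]
  have hz : IsZero (Abelian.image f) := by
    refine isZero_of_maps_from_killed ha hn fun W x hW => ?_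
    rw [← Abelian.image.fac x]
    obtain ⟨A, ⟨e⟩⟩ := hF.exists_iso (Abelian.image x)
      (hW.of_epi (Abelian.factorThruImage x))
    have h1 : 𝟙 A = 0 := (Preadditive.isCoseparator_iff _).mp hJ _ fun g => by
      apply F.map_injective
      let m := e.hom ≫ Abelian.image.ι x ≫ Abelian.image.ι f
      have hm : m ≫ Injective.factorThru (F.map g ≫ j) m = F.map g ≫ j :=
        Injective.comp_factorThru _ _
      have hm' : m ≫ Injective.factorThru (F.map g ≫ j) m = 0 := by
        simp only [m, Category.assoc, hι, comp_zero]
      rw [Category.id_comp, F.map_zero, ← cancel_mono j, zero_comp, ← hm, hm']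
    have h2 := congr_arg F.map h1
    rw [F.map_id, F.map_zero, ← IsZero.iff_id_eq_zero] at h2
    rw [h2.eq_of_src (e.hom ≫ Abelian.image.ι x) 0 |> fun h => (cancel_epi e.hom).mp
      (h.trans comp_zero.symm), comp_zero]
  rw [← Abelian.image.fac f, hz.eq_of_src (Abelian.image.ι f) 0, comp_zero]

end Limits

lemma wellPowered_of_isCoseparator {C : Type u} [Category.{v} C] [Abelian C] {E : C}
    (hE : IsCoseparator E) : WellPowered.{v} C := by
  have : WellPowered.{v} Cᵒᵖ :=
    wellPowered_of_isSeparator (Opposite.op E) ((isSeparator_op_iff E).mpr hE)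
  exact wellPowered_of_equiv.{v} (opOpEquivalence C)

/-! ### Exactness of filtered colimits -/

section Cocycles

variable {J : Type w} [Category.{w} J]

/-- The vanishing of the first cohomology of the diagram `i ↦ Hom(Z i, E)`, that is, of
`lim¹ Hom(Z, E)`: each `1`-cocycle is a coboundary. -/
def CocyclesBound {C : Type u} [Category.{v} C] [Preadditive C] (Z : J ⥤ C) (E : C) : Prop :=
  ∀ c : ∀ ⦃i j : J⦄, (i ⟶ j) → (Z.obj i ⟶ E),
    (∀ ⦃i j k : J⦄ (f : i ⟶ j) (g : j ⟶ k), c (f ≫ g) = c f + Z.map f ≫ c g) →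
    ∃ z : ∀ i, Z.obj i ⟶ E, ∀ ⦃i j : J⦄ (f : i ⟶ j), c f = Z.map f ≫ z j - z i

/-- A cocycle defines an extension of `Z` by the constant diagram `N`; exactness of the colimit
and injectivity of `N` split it compatibly with the transition maps. -/
lemma cocyclesBound_of_hasExactColimits {D : Type u'} [Category.{v'} D] [Abelian D]
    [HasColimitsOfShape J D] [HasExactColimitsOfShape J D] (Z : J ⥤ D) (N : D) [Injective N] :
    CocyclesBound Z N := by
  intro c hc
  have hc1 (i : J) : c (𝟙 i) = 0 := by
    have := hc (𝟙 i) (𝟙 i)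
    simpa using this
  let W : J ⥤ D :=
    { obj := fun i => N ⊞ Z.obj i
      map := fun f => biprod.desc biprod.inl (biprod.lift (c f) (Z.map f))
      map_id := fun i => by ext <;> simp [hc1]
      map_comp := fun f g => by ext <;> simp [hc] }
  let φ : (Functor.const J).obj N ⟶ W :=
    { app := fun i => biprod.inl
      naturality := fun i j f => by simp [W] }
  have (i : J) : Mono (φ.app i) := inferInstanceAs (Mono (biprod.inl : N ⟶ N ⊞ Z.obj i))
  have : Mono φ := NatTrans.mono_of_mono_app φ
  have : Mono (colimMap φ) := inferInstanceAs (Mono (colim.map φ))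
  let r : colimit W ⟶ N :=
    Injective.factorThru (colimit.desc ((Functor.const J).obj N) ⟨N, 𝟙 _⟩) (colimMap φ)
  have hr : colimMap φ ≫ r = colimit.desc ((Functor.const J).obj N) ⟨N, 𝟙 _⟩ :=
    Injective.comp_factorThru _ _
  have hr' (i : J) : biprod.inl ≫ colimit.ι W i ≫ r = 𝟙 N := by
    have := colimit.ι ((Functor.const J).obj N) i ≫= hr
    rw [ι_colimMap_assoc, colimit.ι_desc] at this
    exact this
  refine ⟨fun i => -(biprod.inr ≫ colimit.ι W i ≫ r), fun i j f => ?_⟩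
  have h : biprod.inr ≫ W.map f = c f ≫ biprod.inl + Z.map f ≫ biprod.inr := by
    ext <;> simp [W]
  have h1 : (biprod.inr : Z.obj i ⟶ N ⊞ Z.obj i) ≫ colimit.ι W i ≫ r =
      c f + Z.map f ≫ biprod.inr ≫ colimit.ι W j ≫ r := by
    rw [← colimit.w_assoc W f, reassoc_of% h, Preadditive.add_comp, Category.assoc, hr',
      Category.comp_id, Category.assoc]
  change c f = Z.map f ≫ (-(biprod.inr ≫ colimit.ι W j ≫ r)) - -(biprod.inr ≫ colimit.ι W i ≫ r)
  rw [h1, Preadditive.comp_neg]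
  abel

end Cocycles

section AB5

variable {R : Type w} [CommRing R] {C : Type u} [Category.{v} C] [Abelian C] [Linear R C]
  {D : Type u'} [Category.{v'} D] [Abelian D] {a : Ideal R} {F : D ⥤ C} [F.Full] [F.Faithful]
  {J : Type w} [Category.{w} J]

/-- Dévissage along the functorial torsion subobjects of the diagram. -/
lemma cocyclesBound_of_injective (hF : IsKilledInclusion a F) (ha : a.FG) (hn : IsNilpotent a)
    [HasColimitsOfShape J D] [HasExactColimitsOfShape J D] (Z : J ⥤ C) (E : C) [Injective E] :
    CocyclesBound Z E := by
  have := hF.isLeftAdjoint ha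
  obtain ⟨G, ⟨adj⟩⟩ := this.exists_rightAdjoint
  have := hF.preservesMonomorphisms
  have : Injective (G.obj E) := adj.map_injective _ inferInstance
  have : F.Additive := by
    have := preservesBinaryBiproducts_of_preservesBinaryCoproducts F
    exact Functor.additive_of_preservesBinaryBiproducts F
  obtain ⟨n, hn⟩ := hn
  have key (k : ℕ) : ∀ Z : J ⥤ C, (∀ i, KilledBy (a ^ k) (Z.obj i)) → CocyclesBound Z E := by
    induction k with
    | zero =>
      intro Z hZ c _
      have h (i : J) : IsZero (Z.obj i) := KilledBy.isZero (by simpa using hZ i)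
      exact ⟨fun i => 0, fun i j f => (h i).eq_of_src _ _⟩
    | succ k ih =>
      intro Z hZ c hc
      let τ (i : J) : F.obj (G.obj (Z.obj i)) ⟶ Z.obj i := adj.counit.app (Z.obj i)
      have (i : J) : Mono (τ i) := hF.mono_counit adj _
      have hτ {i j : J} (f : i ⟶ j) : τ i ≫ Z.map f = F.map (G.map (Z.map f)) ≫ τ j :=
        (adj.counit.naturality (Z.map f)).symm
      let Q : J ⥤ C :=
        { obj := fun i => cokernel (τ i)
          map := fun f => cokernel.map _ _ (F.map (G.map (Z.map f))) (Z.map f) (hτ f)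
          map_id := fun i => by ext; simp
          map_comp := fun f g => by ext; simp }
      let π (i : J) : Z.obj i ⟶ Q.obj i := cokernel.π (τ i)
      have (i : J) : Epi (π i) := inferInstanceAs (Epi (cokernel.π (τ i)))
      have hπ {i j : J} (f : i ⟶ j) : π i ≫ Q.map f = Z.map f ≫ π j := by simp [π, Q]
      have hQ (i : J) : KilledBy (a ^ k) (Q.obj i) := by
        obtain ⟨T, t, _, hT, ht⟩ := exists_torsion ha (Z.obj i)
        refine KilledBy.of_torsion_quotient (cokernel.condition (τ i)) (hZ i) fun W f hf => ?_
        obtain ⟨g, rfl⟩ := ht W f hf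
        obtain ⟨g', hg'⟩ := hF.exists_lift_counit adj hT t
        exact ⟨g ≫ g', by rw [Category.assoc, hg']⟩
      -- The restriction of the cocycle to the torsion is a coboundary in `D`.
      obtain ⟨z, hz⟩ : ∃ z : ∀ i, G.obj (Z.obj i) ⟶ G.obj E, ∀ ⦃i j : J⦄ (f : i ⟶ j),
          adj.homEquiv _ _ (τ i ≫ c f) = G.map (Z.map f) ≫ z j - z i :=
        cocyclesBound_of_hasExactColimits (Z ⋙ G) (G.obj E)
          (fun i j f => adj.homEquiv _ _ (τ i ≫ c f)) fun i j k f g => by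
          apply (adj.homEquiv _ _).symm.injective
          rw [Equiv.symm_apply_apply, Adjunction.homEquiv_counit, F.map_add, Preadditive.add_comp,
            ← Adjunction.homEquiv_counit, Equiv.symm_apply_apply, F.map_comp, Category.assoc,
            ← Adjunction.homEquiv_counit, Equiv.symm_apply_apply, hc, Preadditive.comp_add,
            ← Category.assoc (τ i), hτ, Category.assoc]
          rfl
      -- Subtracting an extension of it to `Z` leaves a cocycle on the quotient by the torsion.
      let y (i : J) : Z.obj i ⟶ E :=
        Injective.factorThru (F.map (z i) ≫ adj.counit.app E) (τ i)
      have hy (i : J) : τ i ≫ y i = F.map (z i) ≫ adj.counit.app E :=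
        Injective.comp_factorThru _ _
      have hd {i j : J} (f : i ⟶ j) : τ i ≫ (c f - (Z.map f ≫ y j - y i)) = 0 := by
        have h : τ i ≫ c f = F.map (G.map (Z.map f) ≫ z j - z i) ≫ adj.counit.app E := by
          rw [← hz f]
          exact ((adj.homEquiv_counit ..).symm.trans (Equiv.symm_apply_apply _ _)).symm
        rw [F.map_sub, F.map_comp, Preadditive.sub_comp, Category.assoc] at h
        rw [Preadditive.comp_sub, Preadditive.comp_sub, reassoc_of% hτ f, hy, hy, h, sub_eq_zero]
      let d ⦃i j : J⦄ (f : i ⟶ j) : Q.obj i ⟶ E := cokernel.desc (τ i) _ (hd f)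
      have hπd {i j : J} (f : i ⟶ j) : π i ≫ d f = c f - (Z.map f ≫ y j - y i) :=
        cokernel.π_desc _ _ _
      obtain ⟨x, hx⟩ := ih Q hQ d fun i j k f g => by
        rw [← cancel_epi (π i), hπd, Preadditive.comp_add, hπd, reassoc_of% hπ f, hπd, hc]
        simp only [Preadditive.comp_sub, Z.map_comp, Category.assoc]
        abel
      refine ⟨fun i => y i + π i ≫ x i, fun i j f => ?_⟩
      have h := hπd f
      rw [hx, Preadditive.comp_sub, reassoc_of% hπ f] at h
      change c f = Z.map f ≫ (y j + π j ≫ x j) - (y i + π i ≫ x i)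
      rw [Preadditive.comp_add, ← sub_eq_zero, ← sub_eq_zero.mpr h.symm]
      abel
  refine key n Z fun i r hr => ?_
  rw [hn] at hr
  rw [(Submodule.mem_bot R).mp hr, zero_smul]

/-- If `lim¹ Hom(Z, E)` vanishes for injective `E`, then cocones over a subdiagram with injective
vertex extend to the ambient diagram, so that monomorphisms of diagrams have monic colimits. -/
lemma hasExactColimitsOfShape_of_cocyclesBound [EnoughInjectives C] [HasColimitsOfShape J C]
    (h : ∀ (Z : J ⥤ C) (E : C) [Injective E], CocyclesBound Z E) :
    HasExactColimitsOfShape J C := by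
  have : (colim (J := J) (C := C)).PreservesMonomorphisms := by
    refine ⟨fun {X Y} m _ => ?_⟩
    let E := Injective.under (colimit X)
    let ι : colimit X ⟶ E := Injective.ι (colimit X)
    have : Mono ι := Injective.ι_mono _
    let x (i : J) : X.obj i ⟶ E := colimit.ι X i ≫ ι
    have hx {i j : J} (f : i ⟶ j) : X.map f ≫ x j = x i := colimit.w_assoc X f _
    let y (i : J) : Y.obj i ⟶ E := Injective.factorThru (x i) (m.app i)
    have hy (i : J) : m.app i ≫ y i = x i := Injective.comp_factorThru _ _
    let Z : J ⥤ C :=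
      { obj := fun i => cokernel (m.app i)
        map := fun f => cokernel.map _ _ (X.map f) (Y.map f) (m.naturality f).symm
        map_id := fun i => by ext; simp
        map_comp := fun f g => by ext; simp }
    let π (i : J) : Y.obj i ⟶ Z.obj i := cokernel.π (m.app i)
    have (i : J) : Epi (π i) := inferInstanceAs (Epi (cokernel.π (m.app i)))
    have hmπ (i : J) : m.app i ≫ π i = 0 := cokernel.condition _
    have hπ {i j : J} (f : i ⟶ j) : π i ≫ Z.map f = Y.map f ≫ π j := by simp [π, Z]
    let c ⦃i j : J⦄ (f : i ⟶ j) : Z.obj i ⟶ E := cokernel.desc (m.app i) (Y.map f ≫ y j - y i) (by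
      rw [Preadditive.comp_sub, ← m.naturality_assoc, hy, hy, hx, sub_self])
    have hπc {i j : J} (f : i ⟶ j) : π i ≫ c f = Y.map f ≫ y j - y i := cokernel.π_desc _ _ _
    obtain ⟨z, hz⟩ := h Z E c fun i j k f g => by
      rw [← cancel_epi (π i), Preadditive.comp_add, hπc, hπc, reassoc_of% hπ f, hπc,
        Preadditive.comp_sub, Y.map_comp, Category.assoc]
      abel
    let s : Cocone Y := Cocone.mk E
      { app := fun i => y i - π i ≫ z i
        naturality := fun i j f => by
          have h := hπc f
          rw [hz, Preadditive.comp_sub, reassoc_of% hπ f] at h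
          dsimp
          rw [Category.comp_id, Preadditive.comp_sub, ← sub_eq_zero, ← sub_eq_zero.mpr h.symm]
          abel }
    have hs : colim.map m ≫ colimit.desc Y s = ι := by
      refine colimit.hom_ext fun i => ?_
      change colimit.ι X i ≫ colimMap m ≫ _ = _
      rw [ι_colimMap_assoc, colimit.ι_desc]
      change m.app i ≫ (y i - π i ≫ z i) = x i
      rw [Preadditive.comp_sub, hy, reassoc_of% hmπ i, zero_comp, sub_zero]
    exact mono_of_mono_fac hs
  exact hasExactColimitsOfShape_of_preservesMono C J

end AB5

/-! ### Existence of a separator -/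

section Separator

variable {R : Type w} [CommRing R] {C : Type u} [Category.{w} C] [Abelian C] [Linear R C]

lemma KilledBy.of_generators {n : ℕ} {s : Fin n → R} {X : C} (h : ∀ l, s l • 𝟙 X = 0) :
    KilledBy (Submodule.span R (Set.range s)) X := fun r hr => by
  induction hr using Submodule.span_induction with
  | mem r hr => obtain ⟨l, rfl⟩ := hr; exact h l
  | zero => exact zero_smul _ _
  | add r r' _ _ h h' => rw [add_smul, h, h', add_zero]
  | smul t r _ h => rw [smul_eq_mul, mul_smul, h, smul_zero]

/-- The coproduct of the subobjects of `W` maps onto each object that embeds into `W`. -/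
lemma exists_epi_to_subobjects [HasCoproducts.{w} C] (W : C) [Small.{w} (Subobject W)] :
    ∃ Z : C, ∀ (P : C) (m : P ⟶ W) [Mono m], ∃ z : Z ⟶ P, Epi z := by
  classical
  let f (s : Shrink.{w} (Subobject W)) : C := ((equivShrink _).symm s : Subobject W)
  refine ⟨∐ f, fun P m _ => ?_⟩
  let s := equivShrink (Subobject W) (Subobject.mk m)
  have hs : (equivShrink _).symm s = Subobject.mk m := Equiv.symm_apply_apply _ _
  let e : f s ≅ P := Subobject.isoOfEq _ _ hs ≪≫ Subobject.underlyingIso m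
  exact ⟨Sigma.π f s ≫ e.hom, inferInstance⟩

/-- An epimorphism `y : Y ⟶ T` restricts to an epimorphism from the image of a coproduct of copies
of a separator, indexed by the subobjects of `T` independently of `Y`. -/
lemma exists_bounded_epi {D : Type u'} [Category.{w} D] [Abelian D] [HasCoproducts.{w} D]
    {G : D} (hG : IsSeparator G) {Y T : D} [Small.{w} (Subobject T)] (y : Y ⟶ T) [Epi y] :
    ∃ η : (∐ fun _ : Shrink.{w} (Subobject T) => G) ⟶ Y, Epi (η ≫ y) := by
  classical
  let g (s : Shrink.{w} (Subobject T)) : G ⟶ Y :=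
    if h : ∃ g : G ⟶ Y, imageSubobject (g ≫ y) = (equivShrink _).symm s then h.choose else 0
  refine ⟨Sigma.desc g, Preadditive.epi_of_cancel_zero _ fun {Z} z hz => ?_⟩
  rw [← cancel_epi y, comp_zero]
  refine (Preadditive.isSeparator_iff _).mp hG _ fun x => ?_
  have h : ∃ g : G ⟶ Y, imageSubobject (g ≫ y) =
      (equivShrink _).symm (equivShrink _ (imageSubobject (x ≫ y))) :=
    ⟨x, (Equiv.symm_apply_apply _ _).symm⟩
  have hg : imageSubobject (g (equivShrink _ (imageSubobject (x ≫ y))) ≫ y) =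
      imageSubobject (x ≫ y) := by
    simp only [g, dif_pos h]
    rw [h.choose_spec, Equiv.symm_apply_apply]
  have h0 : (imageSubobject (g (equivShrink _ (imageSubobject (x ≫ y))) ≫ y)).arrow ≫ z = 0 := by
    rw [← cancel_epi (factorThruImageSubobject _), imageSubobject_arrow_comp_assoc, comp_zero]
    simpa using Sigma.ι (fun _ : Shrink.{w} (Subobject T) => G) _ ≫= hz
  rw [hg] at h0
  rw [← Category.assoc, ← imageSubobject_arrow_comp (x ≫ y), Category.assoc, h0, comp_zero]

/-- The quotients of `U` embed into a fixed power of an injective coseparator. -/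
lemma mono_to_power {E : C} (hE : IsCoseparator E) {U V : C} (q : U ⟶ V) [Epi q]
    [HasProduct fun _ : U ⟶ E => E] : ∃ v : V ⟶ ∏ᶜ fun _ : U ⟶ E => E, Mono v := by
  classical
  let c (f : U ⟶ E) : V ⟶ E := if h : ∃ x : V ⟶ E, q ≫ x = f then h.choose else 0
  refine ⟨Pi.lift c, Preadditive.mono_of_cancel_zero _ fun {X} x hx => ?_⟩
  refine (Preadditive.isCoseparator_iff _).mp hE _ fun h => ?_
  have hc : c (q ≫ h) = h := by
    have h' : ∃ x : V ⟶ E, q ≫ x = q ≫ h := ⟨h, rfl⟩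
    simp only [c, dif_pos h']
    rw [← cancel_epi q, h'.choose_spec]
  have := hx =≫ Pi.π _ (q ≫ h)
  rw [Category.assoc, Pi.lift_π, hc, zero_comp] at this
  exact this

variable {D : Type u'} [Category.{w} D] [Abelian D] {a : Ideal R} {F : D ⥤ C} [F.Full] [F.Faithful]

/-- An epimorphism `p : P ⟶ T` whose kernel is annihilated by `a` remains epi on a subobject `P'`
of `P` of bounded size: since the multiplications by elements of `a` factor through `T`, the
subobject `a P` is a quotient of a finite power of `T`, and it suffices that `P'` is an extension
by `a P` of a large enough part of the annihilated object `P / a P`. -/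
lemma exists_cover_of_killed_kernel (hF : IsKilledInclusion a F) (ha : a.FG)
    [HasCoproducts.{w} C] [HasProducts.{w} C] [∀ X : C, Small.{w} (Subobject X)]
    [HasCoproducts.{w} D] [∀ X : D, Small.{w} (Subobject X)] {G : D} (hG : IsSeparator G)
    {E : C} [Injective E] (hE : IsCoseparator E)
    (T : C) : ∃ Z : C, ∀ (P : C) (p : P ⟶ T) [Epi p],
      (∀ r ∈ a, ∃ μ : T ⟶ P, p ≫ μ = r • 𝟙 P) → ∃ z : Z ⟶ P, Epi (z ≫ p) := by
  obtain ⟨n, s, rfl⟩ := Submodule.fg_iff_exists_fin_generating_family.mp ha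
  let U : C := ∐ fun _ : Fin n => T
  let c₀ : U ⟶ T := Sigma.desc fun l => s l • 𝟙 T
  have hT₀ : KilledBy (Submodule.span R (Set.range s)) (cokernel c₀) :=
    KilledBy.of_generators fun l => by
      have h := Sigma.ι (fun _ : Fin n => T) l ≫= cokernel.condition c₀
      rw [← Category.assoc, Sigma.ι_desc, comp_zero, Linear.smul_comp, Category.id_comp] at h
      rw [← cancel_epi (cokernel.π c₀), Linear.comp_smul, Category.comp_id, h, comp_zero]
  obtain ⟨T₀, ⟨eT⟩⟩ := hF.exists_iso _ hT₀
  let H : D := ∐ fun _ : Shrink.{w} (Subobject T₀) => G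
  obtain ⟨Z, hZ⟩ := exists_epi_to_subobjects ((∏ᶜ fun _ : U ⟶ E => E) ⊞ F.obj H)
  refine ⟨Z, fun P p _ hμ => ?_⟩
  choose μ hμ using fun l => hμ (s l) (Submodule.subset_span (Set.mem_range_self l))
  have hμp (l : Fin n) : μ l ≫ p = s l • 𝟙 T := by
    rw [← cancel_epi p, ← Category.assoc, hμ, Linear.smul_comp, Linear.comp_smul, Category.id_comp,
      Category.comp_id]
  let c : U ⟶ P := Sigma.desc μ
  have hcp : c ≫ p = c₀ := Sigma.hom_ext _ _ fun l => by simp [c, c₀, hμp]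
  have hP : KilledBy (Submodule.span R (Set.range s)) (cokernel c) :=
    KilledBy.of_generators fun l => by
      have h : μ l ≫ cokernel.π c = 0 := by
        have := Sigma.ι (fun _ : Fin n => T) l ≫= cokernel.condition c
        rwa [← Category.assoc, Sigma.ι_desc, comp_zero] at this
      rw [← cancel_epi (cokernel.π c), Linear.comp_smul, Category.comp_id,
        ← Category.id_comp (cokernel.π c), ← Linear.smul_comp, ← hμ, Category.assoc, h, comp_zero,
        comp_zero]
  obtain ⟨Y, ⟨eP⟩⟩ := hF.exists_iso _ hP
  let p' : cokernel c ⟶ cokernel c₀ := cokernel.desc c (p ≫ cokernel.π c₀) (by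
    rw [reassoc_of% hcp, cokernel.condition])
  have hp' : cokernel.π c ≫ p' = p ≫ cokernel.π c₀ := cokernel.π_desc _ _ _
  have : Epi p' := epi_of_epi_fac hp'
  let y : Y ⟶ T₀ := F.preimage (eP.hom ≫ p' ≫ eT.inv)
  have hy : F.map y = eP.hom ≫ p' ≫ eT.inv := F.map_preimage _
  have : Epi y := F.epi_of_epi_map (by rw [hy]; infer_instance)
  obtain ⟨η, _⟩ := exists_bounded_epi hG y
  let fst : pullback (cokernel.π c) (F.map η ≫ eP.hom) ⟶ P := pullback.fst _ _
  let snd : pullback (cokernel.π c) (F.map η ≫ eP.hom) ⟶ F.obj H := pullback.snd _ _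
  have hfs : fst ≫ cokernel.π c = snd ≫ F.map η ≫ eP.hom := pullback.condition
  have : Epi snd := inferInstanceAs (Epi (pullback.snd (cokernel.π c) (F.map η ≫ eP.hom)))
  have hepi : Epi (fst ≫ p) := Preadditive.epi_of_cancel_zero _ fun {Z'} z hz => by
    let l : U ⟶ pullback (cokernel.π c) (F.map η ≫ eP.hom) :=
      pullback.lift c 0 (by rw [cokernel.condition, zero_comp])
    have hl : l ≫ fst = c := pullback.lift_fst _ _ _
    have h0 : c₀ ≫ z = 0 := by
      rw [← hcp, ← hl, Category.assoc, Category.assoc, ← Category.assoc fst, hz, comp_zero]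
    obtain ⟨z', rfl⟩ : ∃ z' : cokernel c₀ ⟶ Z', cokernel.π c₀ ≫ z' = z :=
      ⟨cokernel.desc _ z h0, cokernel.π_desc _ _ _⟩
    have h1 : fst ≫ p ≫ cokernel.π c₀ = snd ≫ F.map (η ≫ y) ≫ eT.hom := by
      rw [← hp', reassoc_of% hfs, F.map_comp, hy]
      simp
    have := hF.preservesEpimorphisms
    rw [Category.assoc, ← Category.assoc p, ← Category.assoc fst, h1] at hz
    rw [(cancel_epi (snd ≫ F.map (η ≫ y) ≫ eT.hom)).mp (hz.trans comp_zero.symm), comp_zero]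
  -- The kernel `Abelian.image c` of the projection to `F.obj H` is a quotient of `U`.
  obtain ⟨v, _⟩ := mono_to_power hE (Abelian.factorThruImage c)
  let ν : Abelian.image c ⟶ pullback (cokernel.π c) (F.map η ≫ eP.hom) :=
    pullback.lift (Abelian.image.ι c) 0 (by rw [zero_comp]; exact kernel.condition _)
  have hν : ν ≫ fst = Abelian.image.ι c := pullback.lift_fst _ _ _
  have hν' : ν ≫ snd = 0 := pullback.lift_snd _ _ _
  have : Mono ν := mono_of_mono_fac hν
  let ε := Injective.factorThru v ν
  have hε : ν ≫ ε = v := Injective.comp_factorThru _ _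
  have : Mono (biprod.lift ε snd) := Preadditive.mono_of_cancel_zero _ fun {X} x hx => by
    have h1 : x ≫ ε = 0 := by simpa using hx =≫ biprod.fst
    have h2 : x ≫ snd = 0 := by simpa using hx =≫ biprod.snd
    obtain ⟨x', hx'⟩ : ∃ x' : X ⟶ Abelian.image c, x' ≫ Abelian.image.ι c = x ≫ fst := by
      have h3 : (x ≫ fst) ≫ cokernel.π c = 0 := by
        rw [Category.assoc, hfs, reassoc_of% h2, zero_comp]
      exact ⟨kernel.lift _ _ h3, kernel.lift_ι _ _ _⟩
    obtain rfl : x' ≫ ν = x := pullback.hom_ext (by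
      rw [Category.assoc]
      exact (congr_arg (x' ≫ ·) hν).trans hx') (by
      rw [Category.assoc]
      exact ((congr_arg (x' ≫ ·) hν').trans comp_zero).trans h2.symm)
    rw [Category.assoc, hε] at h1
    rw [zero_of_comp_mono v h1, zero_comp]
  obtain ⟨z, _⟩ := hZ _ (biprod.lift ε snd)
  exact ⟨z ≫ fst, by rw [Category.assoc]; infer_instance⟩

/-- The condition on `r • 𝟙 P` says that the kernel of `p` is annihilated by `a ^ k`. -/
lemma exists_cover_of_kernel_killed_by_pow (hF : IsKilledInclusion a F) (ha : a.FG)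
    [HasCoproducts.{w} C] [HasProducts.{w} C] [∀ X : C, Small.{w} (Subobject X)]
    [HasCoproducts.{w} D] [∀ X : D, Small.{w} (Subobject X)] {G : D} (hG : IsSeparator G)
    {E : C} [Injective E] (hE : IsCoseparator E)
    (T : C) (k : ℕ) : ∃ Z : C, ∀ (P : C) (p : P ⟶ T) [Epi p],
      (∀ r ∈ a ^ k, ∃ μ : T ⟶ P, p ≫ μ = r • 𝟙 P) → ∃ z : Z ⟶ P, Epi (z ≫ p) := by
  induction k with
  | zero =>
    refine ⟨T, fun P p _ hμ => ?_⟩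
    obtain ⟨μ, hμ⟩ := hμ 1 (by simp)
    rw [one_smul] at hμ
    exact ⟨μ, by
      have : μ ≫ p = 𝟙 T := by rw [← cancel_epi p, reassoc_of% hμ, Category.comp_id]
      rw [this]; infer_instance⟩
  | succ k ih =>
    obtain ⟨Z₁, hZ₁⟩ := ih
    obtain ⟨Z, hZ⟩ := exists_cover_of_killed_kernel hF ha hG hE Z₁
    refine ⟨Z, fun P p _ hμ => ?_⟩
    -- Divide `P` by the `a`-torsion `K` of the kernel of `p`.
    obtain ⟨K, τ, _, hK, hτ⟩ := exists_torsion ha (kernel p)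
    let t : K ⟶ P := τ ≫ kernel.ι p
    have : Mono t := mono_comp _ _
    let π := cokernel.π t
    have htπ : t ≫ π = 0 := cokernel.condition t
    let p' : cokernel t ⟶ T := cokernel.desc t p (by simp [t])
    have hp' : π ≫ p' = p := cokernel.π_desc _ _ _
    have : Epi p' := epi_of_epi_fac hp'
    obtain ⟨z₁, _⟩ := hZ₁ (cokernel t) p' fun r hr => by
      obtain ⟨g, hg⟩ := hτ _ (r • 𝟙 (kernel p)) fun x hx => by
        obtain ⟨μ, hμ⟩ := hμ (x * r) (pow_succ' a k ▸ Ideal.mul_mem_mul hx hr)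
        rw [smul_smul, ← cancel_mono (kernel.ι p), Linear.smul_comp, Category.id_comp, zero_comp,
          ← Category.comp_id (kernel.ι p), ← Linear.comp_smul, ← hμ, kernel.condition_assoc,
          zero_comp]
      have h : kernel.ι p ≫ (r • π) = 0 := by
        rw [Linear.comp_smul, ← Linear.smul_comp, ← Category.id_comp (kernel.ι p),
          ← Linear.smul_comp, ← hg, Category.assoc, Category.assoc, ← Category.assoc τ, htπ,
          comp_zero]
      refine ⟨Abelian.epiDesc p (r • π) h, ?_⟩
      rw [← cancel_epi π, reassoc_of% hp', Abelian.comp_epiDesc, Linear.comp_smul, Category.comp_id]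
    let q : pullback π z₁ ⟶ Z₁ := pullback.snd π z₁
    have : Epi q := inferInstanceAs (Epi (pullback.snd π z₁))
    obtain ⟨z, _⟩ := hZ (pullback π z₁) q fun r hr => by
      have h : kernel.ι q ≫ (r • 𝟙 (pullback π z₁)) = 0 := by
        rw [Linear.comp_smul, Category.comp_id]
        have h1 : (kernel.ι q ≫ pullback.fst π z₁) ≫ π = 0 := by
          rw [Category.assoc, pullback.condition, ← Category.assoc]
          exact (congr_arg (· ≫ z₁) (kernel.condition q)).trans zero_comp
        have h2 : r • (kernel.ι q ≫ pullback.fst π z₁) = 0 := by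
          rw [← Abelian.monoLift_comp t _ h1, ← Linear.comp_smul, hK.smul_from _ hr, comp_zero]
        refine pullback.hom_ext ?_ ?_
        · rw [Linear.smul_comp, h2, zero_comp]
        · rw [Linear.smul_comp, zero_comp]
          exact (congr_arg (r • ·) (kernel.condition q)).trans (smul_zero _)
      exact ⟨Abelian.epiDesc q _ h, Abelian.comp_epiDesc _ _ _⟩
    refine ⟨z ≫ pullback.fst π z₁, ?_⟩
    have : (z ≫ pullback.fst π z₁) ≫ p = (z ≫ q) ≫ z₁ ≫ p' := by
      rw [← hp', Category.assoc, Category.assoc, pullback.condition_assoc]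
    rw [this]
    exact epi_comp _ _

/-- An object that covers all epimorphisms to the separator of `D` separates the objects of `C`,
by Nakayama's lemma. -/
lemma hasSeparator (hF : IsKilledInclusion a F) (ha : a.FG) (hn : IsNilpotent a)
    [HasCoproducts.{w} C] [HasProducts.{w} C] [∀ X : C, Small.{w} (Subobject X)]
    [HasCoproducts.{w} D] [∀ X : D, Small.{w} (Subobject X)] {G : D} (hG : IsSeparator G)
    {E : C} [Injective E] (hE : IsCoseparator E) : HasSeparator C := by
  obtain ⟨n, hn'⟩ := id hn
  obtain ⟨Z, hZ⟩ := exists_cover_of_kernel_killed_by_pow hF ha hG hE (F.obj G) n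
  replace hZ (P : C) (p : P ⟶ F.obj G) [Epi p] : ∃ z : Z ⟶ P, Epi (z ≫ p) :=
    hZ P p fun r hr => ⟨0, by
      rw [hn'] at hr
      rw [(Submodule.mem_bot R).mp hr, zero_smul, comp_zero]⟩
  have key {X W : C} (x : X ⟶ W) [Epi x] (hW : KilledBy a W) (h : ∀ z : Z ⟶ X, z ≫ x = 0) :
      x = 0 := by
    obtain ⟨Y, ⟨e⟩⟩ := hF.exists_iso W hW
    have hY : 𝟙 Y = 0 := (Preadditive.isSeparator_iff _).mp hG _ fun g => by
      obtain ⟨z, _⟩ := hZ _ (pullback.snd x (F.map g ≫ e.hom))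
      have h1 : (z ≫ pullback.snd x (F.map g ≫ e.hom)) ≫ F.map g ≫ e.hom = 0 := by
        rw [Category.assoc, ← pullback.condition, ← Category.assoc, h]
      have h2 : F.map g ≫ e.hom = 0 := zero_of_epi_comp _ h1
      rw [Category.comp_id]
      exact F.map_injective (by rw [zero_of_comp_mono e.hom h2, F.map_zero])
    have h2 := congr_arg F.map hY
    rw [F.map_id, F.map_zero, ← IsZero.iff_id_eq_zero] at h2
    exact (h2.of_iso e.symm).eq_of_tgt _ _
  refine ⟨Z, (Preadditive.isSeparator_iff _).mpr fun X Y f hf => ?_⟩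
  have hz : IsZero (Abelian.image f) := isZero_of_maps_to_killed ha hn fun W x hW => by
    have h : Abelian.factorThruImage f ≫ Abelian.factorThruImage x = 0 := by
      refine key _ (hW.of_mono (Abelian.image.ι x)) fun z => ?_
      have : z ≫ Abelian.factorThruImage f = 0 := by
        rw [← cancel_mono (Abelian.image.ι f), Category.assoc, Abelian.image.fac, hf, zero_comp]
      rw [reassoc_of% this, zero_comp]
    rw [← Abelian.image.fac x, zero_of_epi_comp _ h, zero_comp]
  rw [← Abelian.image.fac f, hz.eq_of_src (Abelian.image.ι f) 0, comp_zero]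

end Separator

/-! ### Nilpotent deformations of Grothendieck categories -/

/-- Grothendieck's axioms for `C` follow from those for its subcategory of annihilated objects, as
soon as injective objects lift. -/
theorem isGrothendieckAbelian_of_liftsInjectives {R : Type w} [CommRing R] {C : Type u}
    [Category.{w} C] [Abelian C] [Linear R C] {D : Type u'} [Category.{w} D] [Abelian D]
    [IsGrothendieckAbelian.{w} D] {a : Ideal R} {F : D ⥤ C} [F.Full] [F.Faithful]
    (hF : IsKilledInclusion a F) (ha : a.FG) (hn : IsNilpotent a) (hC : LiftsInjectives C a) :
    IsGrothendieckAbelian.{w} C := by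
  have : HasLimitsOfSize.{w, w} D := inferInstance
  have : HasColimitsOfSize.{w, w} D := inferInstance
  have : EnoughInjectives C := enoughInjectives hF ha hn hC
  have : HasProducts.{w} C := fun ι => by
    have h (X : ι → C) : HasProduct X := hasProduct_of_injective_copresentation
      (fun E _ => hasProduct_of_injective hF ha hn hC E) X
    exact ⟨fun K => hasLimit_of_iso Discrete.natIsoFunctor.symm⟩
  have : HasLimits C := has_limits_of_hasEqualizers_and_products
  obtain ⟨J, _, hJ⟩ := Abelian.has_injective_coseparator (separator D) (isSeparator_separator D)
  obtain ⟨E, _, hE⟩ := exists_injective_coseparator hF ha hn hC hJ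
  have hCw : WellPowered.{w} C := wellPowered_of_isCoseparator hE
  have : HasColimits C := hasColimits_of_hasLimits_of_isCoseparating hE
  have hDw : WellPowered.{w} D := inferInstance
  have (X : C) : Small.{w} (Subobject X) := hCw.subobject_small X
  have (X : D) : Small.{w} (Subobject X) := hDw.subobject_small X
  exact
    { locallySmall := inferInstance
      hasFilteredColimitsOfSize := ⟨fun _ _ _ => inferInstance⟩
      ab5OfSize := ⟨fun K _ _ => hasExactColimitsOfShape_of_cocyclesBound fun Z E _ =>
        have : HasExactColimitsOfShape K D := AB5OfSize.ofShape K
        cocyclesBound_of_injective hF ha hn Z E⟩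
      hasSeparator := hasSeparator hF ha hn (isSeparator_separator D) hE }

section Deformation

variable {R S : Type w} [CommRing R] [CommRing S] [Algebra R S]
  {D : Type u'} [Category.{v'} D] [Preadditive D] [Linear S D]
  {C : Type u} [Category.{v} C] [Abelian C] [Linear R C] {F : D ⥤ C}

lemma act_algebraMap (X : SObject R S C) (r : R) :
    (show X.obj ⟶ X.obj from X.act (algebraMap R S r)) = r • 𝟙 X.obj := by
  rw [X.act.commutes]
  rfl

lemma full_of_isDeformation (hsurj : Function.Surjective (algebraMap R S))
    (hF : IsDeformation R S F) : F.Full where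
  map_surjective {A B} g := by
    have := hF.isEquivalence
    let g' : hF.linear.toSObject.obj A ⟶ hF.linear.toSObject.obj B :=
      SObject.Hom.mk g fun s => by
        obtain ⟨r, rfl⟩ := hsurj s
        rw [act_algebraMap, act_algebraMap]
        change (r • 𝟙 (F.obj A)) ≫ g = g ≫ (r • 𝟙 (F.obj B))
        rw [Linear.smul_comp, Linear.comp_smul, Category.id_comp, Category.comp_id]
    exact ⟨hF.linear.toSObject.preimage g',
      congr_arg SObject.Hom.hom (hF.linear.toSObject.map_preimage g')⟩

lemma faithful_of_isDeformation (hF : IsDeformation R S F) : F.Faithful where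
  map_injective {A B} f g h := by
    have := hF.isEquivalence
    exact hF.linear.toSObject.map_injective (SObject.Hom.ext h)

/-- As `R → S` is surjective, an `S`-object is an object annihilated by the kernel. -/
lemma isKilledInclusion_of_isDeformation (hsurj : Function.Surjective (algebraMap R S))
    (hF : IsDeformation R S F) : IsKilledInclusion (RingHom.ker (algebraMap R S)) F where
  killed A r hr := by
    have h := act_algebraMap (hF.linear.toSObject.obj A) r
    rw [(RingHom.mem_ker).mp hr, map_zero] at h
    exact h.symm
  exists_iso X hX := by
    have := hF.isEquivalence
    let φ : S →ₐ[R] End X :=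
      (Ideal.Quotient.liftₐ _ (Algebra.ofId R (End X)) fun r hr => hX r hr).comp
        (Ideal.quotientKerAlgEquivOfSurjective (f := Algebra.ofId R S) hsurj).symm.toAlgHom
    let Y : SObject R S C := ⟨X, φ⟩
    let e := hF.linear.toSObject.objObjPreimageIso Y
    exact ⟨hF.linear.toSObject.objPreimage Y,
      ⟨⟨e.hom.hom, e.inv.hom, congr_arg SObject.Hom.hom e.hom_inv_id,
        congr_arg SObject.Hom.hom e.inv_hom_id⟩⟩⟩

end Deformation

end FlatDeformation

theorem theorem6p29
    (R S : Type w) [CommRing R] [CommRing S] [Algebra R S]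
    [IsCoherentCommRing R] [IsCoherentCommRing S] [Module.FinitePresentation R S]
    (hsurj : Function.Surjective (algebraMap R S))
    (hnil : IsNilpotent (RingHom.ker (algebraMap R S)))
    (D : Type u') [Category.{w} D] [Abelian D] [Linear S D]
    (C : Type u) [Category.{w} C] [Abelian C] [Linear R C]
    (F : D ⥤ C) (hF : IsDeformation R S F) (hflat : IsFlatAbelian R C)
    (hD : IsGrothendieckAbelian.{w} D) :
    IsGrothendieckAbelian.{w} C := by
  have := FlatDeformation.full_of_isDeformation hsurj hF
  have := FlatDeformation.faithful_of_isDeformation hF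
  have ha : (RingHom.ker (algebraMap R S)).FG :=
    Module.FinitePresentation.fg_ker (Algebra.linearMap R S) hsurj
  exact FlatDeformation.isGrothendieckAbelian_of_liftsInjectives
    (FlatDeformation.isKilledInclusion_of_isDeformation hsurj hF) ha hnil
    fun J hJ => FlatDeformation.exists_injective_lift hnil ha
      IsCoherentCommRing.finitePresentation_of_fg
      (fun b hb => FlatDeformation.extendsLocally_of_isFlatAbelian hflat hb) hJ
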